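/- Let $G=(V,E)$ be a finite simple graph and fix a linear order on $V$. A marking of $G$ is a map $m:V\to\{0,1,2\}$ such that the set of vertices with nonzero label is independent; vertices with label $a$ are called $a$-marked, and $V_1=m^{-1}(1)$. Let $T_{i,j}(G)$ be the free abelian group on the markings with exactly $i$ vertices of nonzero label, exactly $j$ of which are $2$-marked, and put $$d m=\sum_{v\in V_1}(-1)^{\#\{w\in V_1\,:\,w<v\}}m_{v\mapsto 0},\qquad \delta m=\sum_{v\in V_1}(-1)^{\#\{w\in V_1\,:\,w<v\}}m_{v\mapsto 2},$$ where $m_{v\mapsto a}$ is obtained from $m$ by changing the label of $v$ to $a$. Then $d^2=\delta^2=0$ and $d\delta+\delta d=0$. Let $(T(G),D)$ be the total complex, $T_n(G)=\bigoplus_{i-j=n}T_{i,j}(G)$, $D=d+\delta$, filtered by the number of $2$-marked vertices, $F_qT_n(G)=\bigoplus_{i-j=n,\ j\ge q}T_{i,j}(G)$. Index its spectral sequence so that $E^r_{p,q}$ lies in total degree $p-q$ and filtration degree $q$; thus $E^0_{p,q}=T_{p,q}(G)$ and $d^r:E^r_{p,q}\to E^r_{p+r-1,\,q+r}$. Write $\mathrm{Ind}(H)$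 for the independence complex of a graph $H$, $\tilde H$ for reduced simplicial homology with integer coefficients (for the empty graph, $\tilde H_{-1}=\mathbb Z$ and $\tilde H_n=0$ for $n\ne -1$), and $G-N[U]$ for the graph obtained from $G$ by deleting all vertices of $U$ and all their neighbors. The spectral sequence of this filtered complex has the following properties. 1. $E^1_{p,q}\cong H_p(T_{\bullet,q}(G),d)$ for all $p,q$, and under this identification $d^1:E^1_{p,q}\to E^1_{p,q+1}$ is given by $d^1[x]=[\delta x]$. 2. $E^1_{p,0}\cong\tilde H_{p-1}(\mathrm{Ind}(G))$ for all $p$. 3. For all $p,q$, $$E^1_{p,q}\cong\bigoplus_{\substack{U\subset V\text{ independent}\\ |U|=q}}\tilde H_{p-q-1}(\mathrm{Ind}(G-N[U])).$$ 4. The spectral sequence converges to $H_\bullet(T(G),D)$: the induced filtration $F_qH_n(T(G),D)$ is finite, and there is $r_1$ such that for all $r\ge r_1$ all differentials $d^r$ vanish and $E^r_{p,q}\cong F_qH_{p-q}(T(G),D)/F_{q+1}H_{p-q}(T(G),D)$ for all $p,q$, the isomorphism being the one that sends the class of a cycle in $F_qT_{p-q}(G)$ to the class of its homology class. 5. $H_0(T(G),D)\cong\mathbb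 Z$ and $H_n(T(G),D)=0$ for $n\neq 0$. 6. There are $(p_0,q_0)$ such that, for all sufficiently large $r$, $E^r_{p_0,q_0}\cong\mathbb Z$ and $E^r_{p,q}=0$ for all $(p,q)\neq(p_0,q_0)$. -/

import Mathlib

open CategoryTheory

universe u

noncomputable section

namespace IndepSS

/-! ### Chain complexes inside one abelian group, their homology, and filtrations -/

/-- A chain complex of abelian groups `… → C_n → C_{n-1} → …`, indexed by `ℤ`, whose chain groups
are subgroups `chains n` of one abelian group `M` and whose differential is the restriction of an
endomorphism `bd` of `M` with square zero. -/
structure SubComplex (M : Type u) [AddCommGroup M] where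
  /-- the differential -/
  bd : M →ₗ[ℤ] M
  /-- the group of `n`-chains -/
  chains : ℤ → Submodule ℤ M
  bd_mem : ∀ (n : ℤ) (x : M), x ∈ chains n → bd x ∈ chains (n - 1)
  bd_bd : ∀ x : M, bd (bd x) = 0

namespace SubComplex

variable {M : Type u} [AddCommGroup M] (C : SubComplex M)

/-- The same object as a chain complex in Mathlib's sense. -/
def toChainComplex : ChainComplex (ModuleCat.{u} ℤ) ℤ where
  X n := ModuleCat.of ℤ (C.chains n)
  d i j :=
    if h : j + 1 = i then
      ModuleCat.ofHom (C.bd.restrict (p := C.chains i) (q := C.chains j) (fun x hx => by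
        have hj : j = i - 1 := by omega
        subst hj
        exact C.bd_mem i x hx))
    else 0
  shape i j h := dif_neg h
  d_comp_d' i j k hij hjk := by
    have h1 : j + 1 = i := hij
    have h2 : k + 1 = j := hjk
    rw [dif_pos h1, dif_pos h2]
    ext x
    exact C.bd_bd _

/-- The `n`-th homology group. -/
abbrev homology (n : ℤ) : ModuleCat.{u} ℤ := C.toChainComplex.homology n

/-- The group of `n`-cycles. -/
def cyc (n : ℤ) : Submodule ℤ M := C.chains n ⊓ LinearMap.ker C.bd

/-- The map that sends an `n`-cycle to its homology class. -/
def cls (n : ℤ) : C.cyc n →ₗ[ℤ] C.homology n :=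
  (C.toChainComplex.liftCycles
      (ModuleCat.ofHom (Submodule.inclusion (inf_le_left : C.cyc n ≤ C.chains n)) :
        ModuleCat.of ℤ (C.cyc n) ⟶ C.toChainComplex.X n)
      (n - 1) ((ComplexShape.down ℤ).next_eq' (by simp))
      (by
        have h : n - 1 + 1 = n := by omega
        ext x
        simp only [toChainComplex, dif_pos h]
        exact Subtype.ext (LinearMap.mem_ker.mp x.2.2)) ≫
    C.toChainComplex.homologyπ n).hom

end SubComplex

/-- The quotient `A / (A ⊓ B)` of a submodule `A` by a submodule `B`. -/
def subquotient {R : Type} [Ring R] {N : Type u} [AddCommGroup N] [Module R N]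
    (A B : Submodule R N) : ModuleCat.{u} R :=
  ModuleCat.of R (A ⧸ B.submoduleOf A)

/-- The class of an element of `A` in `A / (A ⊓ B)`. -/
def subquotientMk {R : Type} [Ring R] {N : Type u} [AddCommGroup N] [Module R N]
    (A B : Submodule R N) (x : N) (hx : x ∈ A) : subquotient A B :=
  (B.submoduleOf A).mkQ ⟨x, hx⟩

/-- A chain complex together with a decreasing filtration
`… ⊇ fil q ⊇ fil (q + 1) ⊇ …` by subcomplexes; `F_q C_n` is `fil q ⊓ chains n`. -/
structure FilteredComplex (M : Type u) [AddCommGroup M] extends SubComplex M where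
  /-- the `q`-th step of the filtration -/
  fil : ℤ → Submodule ℤ M
  fil_anti : ∀ q : ℤ, fil (q + 1) ≤ fil q
  bd_fil : ∀ (q : ℤ) (x : M), x ∈ fil q → bd x ∈ fil q

/-- The shape of the `r`-th page. An entry `(p, q)` sits in filtration degree `q` and in total
degree `p - q`. The differential `d^r` lowers the total degree by one and raises the filtration
degree by `r`, so it goes from `(p, q)` to `(p + r - 1, q + r)`. -/
abbrev pageShape (r : ℤ) : ComplexShape (ℤ × ℤ) := ComplexShape.up' ((r - 1, r) : ℤ × ℤ)

namespace FilteredComplex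

variable {M : Type u} [AddCommGroup M] (C : FilteredComplex M)

/-- `Z^r_{p,q}`: the elements of `F_q C_{p-q}` whose boundary lies in `F_{q+r}`. -/
def approxCycles (r p q : ℤ) : Submodule ℤ M :=
  C.chains (p - q) ⊓ C.fil q ⊓ (C.fil (q + r)).comap C.bd

/-- `Z^{r-1}_{p+1,q+1} + D Z^{r-1}_{p-r+2,q-r+1}`: the elements of `Z^r_{p,q}` that represent
zero on the `r`-th page. -/
def approxBoundaries (r p q : ℤ) : Submodule ℤ M :=
  C.approxCycles (r - 1) (p + 1) (q + 1) ⊔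
    (C.approxCycles (r - 1) (p - r + 2) (q - r + 1)).map C.bd

/-- The data that identify a spectral sequence `E` with the spectral sequence of the filtered
complex `C`: the entry `E^r_{p,q}` is identified, through the projection `proj`, with the quotient
of `Z^r_{p,q}` by the elements that represent zero, the differentials are induced by the
differential of `C`, and the isomorphism between the homology of a page and the next page sends
the class of an element to the element that has the same representative. -/
structure SpectralSequenceData (E : SpectralSequence (ModuleCat.{u} ℤ) pageShape 0) where
  /-- the projection `Z^r_{p,q} → E^r_{p,q}` -/
  proj : ∀ (r : ℤ) (hr : 0 ≤ r) (p q : ℤ), C.approxCycles r p q →ₗ[ℤ] (E.page r hr).X (p, q)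
  proj_surjective : ∀ (r : ℤ) (hr : 0 ≤ r) (p q : ℤ), Function.Surjective (proj r hr p q)
  proj_eq_zero_iff : ∀ (r : ℤ) (hr : 0 ≤ r) (p q : ℤ) (x : C.approxCycles r p q),
    proj r hr p q x = 0 ↔ (x : M) ∈ C.approxBoundaries r p q
  d_proj : ∀ (r : ℤ) (hr : 0 ≤ r) (p q : ℤ) (x : C.approxCycles r p q),
    ∃ h : C.bd x ∈ C.approxCycles r (p + (r - 1)) (q + r),
      ((E.page r hr).d (p, q) (p + (r - 1), q + r)).hom (proj r hr p q x) =
        proj r hr (p + (r - 1)) (q + r) ⟨C.bd x, h⟩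
  iso_proj : ∀ (r : ℤ) (hr : 0 ≤ r) (hr' : 0 ≤ r + 1) (p q : ℤ) (x : C.approxCycles (r + 1) p q),
    ∃ (h : (x : M) ∈ C.approxCycles r p q) (c : (E.page r hr).cycles (p, q)),
      ((E.page r hr).iCycles (p, q)).hom c = proj r hr p q ⟨x, h⟩ ∧
      (E.iso r (r + 1) (p, q) rfl hr).hom.hom (((E.page r hr).homologyπ (p, q)).hom c) =
        proj (r + 1) hr' p q x

/-- The induced filtration of the homology: `F_q H_n` is the group of the classes of cycles
in `F_q C_n`. -/
def homologyFil (q n : ℤ) : Submodule ℤ (C.homology n) :=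
  ((C.fil q).comap (C.cyc n).subtype).map (C.cls n)

/-- The graded piece `F_q H_n / F_{q+1} H_n`. -/
def homologyGr (q n : ℤ) : ModuleCat.{u} ℤ :=
  subquotient (C.homologyFil q n) (C.homologyFil (q + 1) n)

/-- The projection `F_q H_n → F_q H_n / F_{q+1} H_n`. -/
def homologyGrMk (q n : ℤ) (x : C.homology n) (hx : x ∈ C.homologyFil q n) : C.homologyGr q n :=
  subquotientMk (C.homologyFil q n) (C.homologyFil (q + 1) n) x hx

/-- The spectral sequence converges to the homology of `C`: the filtration of the homology is
finite, and from some page on all differentials vanish and `E^r_{p,q}` is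
`F_q H_{p-q} / F_{q+1} H_{p-q}`, by the map that sends the class of a cycle in `F_q C_{p-q}`
to the class of its homology class. -/
def SpectralSequenceData.Converges {C : FilteredComplex M}
    {E : SpectralSequence (ModuleCat.{u} ℤ) pageShape 0} (R : C.SpectralSequenceData E) : Prop :=
  (∃ a b : ℤ, ∀ n : ℤ, C.homologyFil a n = ⊤ ∧ C.homologyFil b n = ⊥) ∧
  ∃ r₁ : ℤ, ∀ (r : ℤ) (hr : 0 ≤ r), r₁ ≤ r →
    (∀ i j : ℤ × ℤ, (E.page r hr).d i j = 0) ∧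
    ∀ p q : ℤ, ∃ e : (E.page r hr).X (p, q) ≃ₗ[ℤ] C.homologyGr q (p - q),
      ∀ x : C.cyc (p - q), (x : M) ∈ C.fil q →
        ∃ (h : (x : M) ∈ C.approxCycles r p q)
          (h' : C.cls (p - q) x ∈ C.homologyFil q (p - q)),
          e (R.proj r hr p q ⟨x, h⟩) = C.homologyGrMk q (p - q) (C.cls (p - q) x) h'

end FilteredComplex

/-! ### Signs -/

section Signs

variable {V : Type u} [LinearOrder V]

/-- The sign `(-1) ^ #{w ∈ S | w < v}`. -/
def sgn (S : Finset V) (v : V) : ℤ := (-1) ^ (S.filter (fun w => w < v)).card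

theorem sgn_erase_of_lt (S : Finset V) {v w : V} (hvw : v < w) : sgn (S.erase w) v = sgn S v := by
  unfold sgn
  congr 2
  ext x
  simp only [Finset.mem_filter, Finset.mem_erase]
  constructor
  · rintro ⟨⟨_, h⟩, h'⟩
    exact ⟨h, h'⟩
  · rintro ⟨h, h'⟩
    exact ⟨⟨(h'.trans hvw).ne, h⟩, h'⟩

theorem sgn_erase_of_gt (S : Finset V) {v w : V} (hv : v ∈ S) (hvw : v < w) :
    sgn (S.erase v) w = - sgn S w := by
  unfold sgn
  have h : S.filter (fun x => x < w) =
      insert v ((S.erase v).filter (fun x => x < w)) := by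
    ext x
    simp only [Finset.mem_filter, Finset.mem_erase, Finset.mem_insert]
    by_cases hx : x = v
    · subst hx
      simp [hv, hvw]
    · simp [hx]
  rw [h, Finset.card_insert_of_notMem (by simp), pow_succ]
  ring

theorem sgn_anticomm (S : Finset V) {v w : V} (hv : v ∈ S) (hw : w ∈ S) (hvw : v ≠ w) :
    sgn S v * sgn (S.erase v) w = - (sgn S w * sgn (S.erase w) v) := by
  rcases lt_or_gt_of_ne hvw with h | h
  · rw [sgn_erase_of_lt S h, sgn_erase_of_gt S hv h]
    ring
  · rw [sgn_erase_of_lt S h, sgn_erase_of_gt S hw h]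
    ring

end Signs

/-! ### Reduced simplicial homology -/

section Simplicial

variable {V : Type u} [LinearOrder V]

/-- The simplicial boundary `∂ s = ∑_{v ∈ s} (-1)^{#{w ∈ s | w < v}} (s \ {v})`, also in the case
where `s` has one element and `s \ {v}` is the empty face. -/
def simplexBd : (Finset V →₀ ℤ) →ₗ[ℤ] (Finset V →₀ ℤ) :=
  Finsupp.linearCombination ℤ fun s => ∑ v ∈ s, sgn s v • Finsupp.single (s.erase v) (1 : ℤ)

theorem simplexBd_single (s : Finset V) :
    simplexBd (Finsupp.single s 1) =
      ∑ v ∈ s, sgn s v • Finsupp.single (s.erase v) (1 : ℤ) := by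
  simp [simplexBd]

theorem simplexBd_simplexBd (x : Finset V →₀ ℤ) : simplexBd (simplexBd x) = 0 := by
  suffices h : simplexBd ∘ₗ simplexBd = (0 : (Finset V →₀ ℤ) →ₗ[ℤ] (Finset V →₀ ℤ)) from
    LinearMap.congr_fun h x
  ext1 s
  ext1
  simp only [LinearMap.comp_apply, Finsupp.lsingle_apply, LinearMap.zero_apply]
  rw [simplexBd_single]
  simp only [map_sum, map_smul, simplexBd_single, Finset.smul_sum, smul_smul]
  set A := ∑ v ∈ s, ∑ w ∈ s.erase v,
    (sgn s v * sgn (s.erase v) w) • Finsupp.single ((s.erase v).erase w) (1 : ℤ) with hA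
  have key : A = -A := by
    conv_lhs => rw [hA, Finset.sum_comm' (t' := s) (s' := fun w => s.erase w)
      (by intro x y; simp only [Finset.mem_erase]; tauto)]
    rw [hA, ← Finset.sum_neg_distrib]
    refine Finset.sum_congr rfl fun v hv => ?_
    rw [← Finset.sum_neg_distrib]
    refine Finset.sum_congr rfl fun w hw => ?_
    rw [Finset.mem_erase] at hw
    rw [Finset.erase_right_comm, sgn_anticomm s hw.2 hv hw.1, neg_smul]
  exact self_eq_neg.mp key

/-- The augmented simplicial chain complex of a simplicial complex `K`, oriented by the order of
the vertices: the group in degree `n` is free on the faces with `n + 1` vertices, where the empty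
face is the generator in degree `-1`. -/
def augmentedChains (K : PreAbstractSimplicialComplex V) : SubComplex (Finset V →₀ ℤ) where
  bd := simplexBd
  chains n := Finsupp.supported ℤ ℤ {s | (s = ∅ ∨ s ∈ K) ∧ (s.card : ℤ) = n + 1}
  bd_mem n x hx := by
    rw [Finsupp.supported_eq_span_single] at hx
    refine Submodule.span_induction (p := fun x _ => simplexBd x ∈ Finsupp.supported ℤ ℤ
      {s : Finset V | (s = ∅ ∨ s ∈ K) ∧ (s.card : ℤ) = n - 1 + 1}) ?_ ?_ ?_ ?_ hx
    · rintro _ ⟨s, ⟨hs, hn⟩, rfl⟩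
      rw [simplexBd_single]
      refine Submodule.sum_mem _ fun v hv => Submodule.smul_mem _ _ ?_
      refine Finsupp.single_mem_supported ℤ 1 ⟨?_, ?_⟩
      · rcases (s.erase v).eq_empty_or_nonempty with h | h
        · exact Or.inl h
        · refine Or.inr ?_
          rcases hs with hs | hs
          · simp [hs] at hv
          · exact (K.isRelLowerSet_faces hs).2 (Finset.erase_subset v s) h
      · have := Finset.card_erase_add_one hv
        omega
    · simp
    · intro x y _ _ h1 h2
      rw [map_add]
      exact Submodule.add_mem _ h1 h2
    · intro a x _ h
      rw [map_smul]
      exact Submodule.smul_mem _ _ h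
  bd_bd := simplexBd_simplexBd

/-- Reduced simplicial homology with integer coefficients. -/
abbrev reducedHomology (K : PreAbstractSimplicialComplex V) (n : ℤ) : ModuleCat.{u} ℤ :=
  (augmentedChains K).homology n

end Simplicial

/-! ### Independence complexes and markings -/

section Graph

variable {V : Type u}

/-- The independence complex `Ind(G)`: its faces are the nonempty finite independent sets. -/
def indComplex (G : SimpleGraph V) : AbstractSimplicialComplex V where
  faces := {s | s.Nonempty ∧ G.IsIndepSet (s : Set V)}
  isRelLowerSet_faces := fun {_} hs =>
    ⟨hs.1, fun _ hts ht => ⟨ht, hs.2.mono (Finset.coe_subset.mpr hts)⟩⟩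
  singleton_mem v := ⟨Finset.singleton_nonempty v, by simp [SimpleGraph.IsIndepSet]⟩

/-- The closed neighborhood `N[U]`. -/
def closedNbhd (G : SimpleGraph V) (U : Set V) : Set V := {w | ∃ v ∈ U, w = v ∨ G.Adj v w}

/-- `G - N[U]`: the graph obtained from `G` by deleting `U` and all neighbors of `U`. -/
abbrev deleteNbhd (G : SimpleGraph V) (U : Set V) : SimpleGraph ↥(closedNbhd G U)ᶜ :=
  G.induce (closedNbhd G U)ᶜ

/-- A labelling `m : V → {0, 1, 2}` is a marking of `G` if the vertices with a nonzero label form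
an independent set. -/
def IsMarking (G : SimpleGraph V) (m : V → Fin 3) : Prop := G.IsIndepSet {v | m v ≠ 0}

theorem isMarking_update [DecidableEq V] {G : SimpleGraph V} {m : V → Fin 3}
    (hm : IsMarking G m) {v : V} (hv : m v = 1) (a : Fin 3) :
    IsMarking G (Function.update m v a) := by
  refine Set.Pairwise.mono ?_ hm
  intro w hw
  by_cases h : w = v
  · subst h
    simp [hv]
  · simpa [h] using hw

variable [Fintype V] [LinearOrder V]

/-- The set of the `a`-marked vertices. -/
def labelled (m : V → Fin 3) (a : Fin 3) : Finset V := Finset.univ.filter fun v => m v = a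

/-- The number `i` of marked vertices. -/
def numMarked (m : V → Fin 3) : ℤ := (Finset.univ.filter fun v => m v ≠ 0).card

/-- The number `j` of 2-marked vertices. -/
def numTwo (m : V → Fin 3) : ℤ := (labelled m 2).card

/-- The linear map with `m ↦ ∑_{v ∈ V_1} (-1)^{#{w ∈ V_1 | w < v}} m_{v ↦ a}`, where `V_1` is the
set of the 1-marked vertices of `m`. -/
def relabel (a : Fin 3) : ((V → Fin 3) →₀ ℤ) →ₗ[ℤ] ((V → Fin 3) →₀ ℤ) :=
  Finsupp.linearCombination ℤ fun m => ∑ v ∈ labelled m 1,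
    sgn (labelled m 1) v • Finsupp.single (Function.update m v a) (1 : ℤ)

/-- The differential `d`, which removes 1-marks. -/
def dMap : ((V → Fin 3) →₀ ℤ) →ₗ[ℤ] ((V → Fin 3) →₀ ℤ) := relabel 0

/-- The differential `δ`, which turns 1-marks into 2-marks. -/
def deltaMap : ((V → Fin 3) →₀ ℤ) →ₗ[ℤ] ((V → Fin 3) →₀ ℤ) := relabel 2

theorem relabel_single (a : Fin 3) (m : V → Fin 3) :
    relabel a (Finsupp.single m 1) = ∑ v ∈ labelled m 1,
      sgn (labelled m 1) v • Finsupp.single (Function.update m v a) (1 : ℤ) := by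
  simp [relabel]

theorem labelled_update (m : V → Fin 3) (v : V) {a : Fin 3} (ha : a ≠ 1) :
    labelled (Function.update m v a) 1 = (labelled m 1).erase v := by
  ext w
  by_cases h : w = v
  · subst h
    simp [labelled, ha]
  · simp [labelled, h]

theorem relabel_anticomm {a b : Fin 3} (ha : a ≠ 1) (hb : b ≠ 1) (x : (V → Fin 3) →₀ ℤ) :
    relabel a (relabel b x) + relabel b (relabel a x) = 0 := by
  suffices h : relabel a ∘ₗ relabel b + relabel b ∘ₗ relabel a =
      (0 : ((V → Fin 3) →₀ ℤ) →ₗ[ℤ] ((V → Fin 3) →₀ ℤ)) from LinearMap.congr_fun h x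
  ext1 m
  ext1
  simp only [LinearMap.comp_apply, Finsupp.lsingle_apply, LinearMap.zero_apply,
    LinearMap.add_apply]
  simp only [relabel_single, map_sum, map_smul, Finset.smul_sum, smul_smul,
    labelled_update _ _ ha, labelled_update _ _ hb]
  conv_lhs =>
    enter [1]
    rw [Finset.sum_comm' (t' := labelled m 1) (s' := fun w => (labelled m 1).erase w)
      (by intro x y; simp only [Finset.mem_erase]; tauto)]
  rw [← Finset.sum_add_distrib]
  refine Finset.sum_eq_zero fun v hv => ?_
  rw [← Finset.sum_add_distrib]
  refine Finset.sum_eq_zero fun w hw => ?_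
  rw [Finset.mem_erase] at hw
  rw [Function.update_comm hw.1, sgn_anticomm _ hw.2 hv hw.1, neg_smul, neg_add_cancel]

theorem relabel_relabel {a : Fin 3} (ha : a ≠ 1) (x : (V → Fin 3) →₀ ℤ) :
    relabel a (relabel a x) = 0 :=
  self_eq_neg.mp (eq_neg_of_add_eq_zero_left (relabel_anticomm ha ha x))

theorem dMap_dMap (x : (V → Fin 3) →₀ ℤ) : dMap (dMap x) = 0 := relabel_relabel (by decide) x

theorem deltaMap_deltaMap (x : (V → Fin 3) →₀ ℤ) : deltaMap (deltaMap x) = 0 :=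
  relabel_relabel (by decide) x

theorem dMap_deltaMap (x : (V → Fin 3) →₀ ℤ) :
    dMap (deltaMap x) + deltaMap (dMap x) = 0 :=
  relabel_anticomm (by decide) (by decide) x

/-- `relabel` maps the span of the labellings in `P` to the span of the labellings in `Q` as soon
as every relabelling of a labelling in `P` lies in `Q`. -/
theorem relabel_mem {a : Fin 3} {P Q : Set (V → Fin 3)}
    (h : ∀ m ∈ P, ∀ v, m v = 1 → Function.update m v a ∈ Q) (x : (V → Fin 3) →₀ ℤ)
    (hx : x ∈ Finsupp.supported ℤ ℤ P) : relabel a x ∈ Finsupp.supported ℤ ℤ Q := by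
  rw [Finsupp.supported_eq_span_single] at hx
  refine Submodule.span_induction
    (p := fun x _ => relabel a x ∈ Finsupp.supported ℤ ℤ Q) ?_ ?_ ?_ ?_ hx
  · rintro _ ⟨m, hm, rfl⟩
    rw [relabel_single]
    refine Submodule.sum_mem _ fun v hv => Submodule.smul_mem _ _ ?_
    exact Finsupp.single_mem_supported ℤ 1 (h m hm v (by simpa [labelled] using hv))
  · simp
  · intro x y _ _ h1 h2
    rw [map_add]
    exact Submodule.add_mem _ h1 h2
  · intro c x _ h
    rw [map_smul]
    exact Submodule.smul_mem _ _ h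

theorem numMarked_update_zero {m : V → Fin 3} {v : V} (hv : m v = 1) :
    numMarked (Function.update m v 0) = numMarked m - 1 := by
  have h : (Finset.univ.filter fun w => Function.update m v 0 w ≠ 0) =
      (Finset.univ.filter fun w => m w ≠ 0).erase v := by
    ext w
    by_cases h : w = v
    · subst h
      simp
    · simp [h]
  have h' := Finset.card_erase_add_one (s := Finset.univ.filter fun w => m w ≠ 0) (a := v)
    (by simp [hv])
  unfold numMarked
  rw [h]
  omega

theorem numMarked_update_two {m : V → Fin 3} {v : V} (hv : m v = 1) :
    numMarked (Function.update m v 2) = numMarked m := by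
  unfold numMarked
  congr 2
  ext w
  by_cases h : w = v
  · subst h
    simp [hv]
  · simp [h]

theorem numTwo_update_zero {m : V → Fin 3} {v : V} (hv : m v = 1) :
    numTwo (Function.update m v 0) = numTwo m := by
  unfold numTwo labelled
  congr 2
  ext w
  by_cases h : w = v
  · subst h
    simp [hv]
  · simp [h]

theorem numTwo_update_two {m : V → Fin 3} {v : V} (hv : m v = 1) :
    numTwo (Function.update m v 2) = numTwo m + 1 := by
  have h : labelled (Function.update m v 2) 2 = insert v (labelled m 2) := by
    ext w
    by_cases h : w = v
    · subst h
      simp [labelled]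
    · simp [labelled, h]
  unfold numTwo
  rw [h, Finset.card_insert_of_notMem (by simp [labelled, hv])]
  push_cast
  ring

/-- `T_{i,j}(G)`: the free abelian group on the markings of `G` with `i` marked vertices in total
and `j` 2-marked vertices. -/
def T (G : SimpleGraph V) (i j : ℤ) : Submodule ℤ ((V → Fin 3) →₀ ℤ) :=
  Finsupp.supported ℤ ℤ {m | IsMarking G m ∧ numMarked m = i ∧ numTwo m = j}

/-- `T_n(G)`, the sum of the `T_{i,j}(G)` with `i - j = n`: the free abelian group on the markings
of `G` with `i - j = n`. -/
def Ttot (G : SimpleGraph V) (n : ℤ) : Submodule ℤ ((V → Fin 3) →₀ ℤ) :=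
  Finsupp.supported ℤ ℤ {m | IsMarking G m ∧ numMarked m - numTwo m = n}

/-- The row `(T_{•,j}(G), d)` of the double complex. -/
def rowComplex (G : SimpleGraph V) (j : ℤ) : SubComplex ((V → Fin 3) →₀ ℤ) where
  bd := dMap
  chains i := T G i j
  bd_mem i x hx := by
    refine relabel_mem ?_ x hx
    rintro m ⟨h1, h2, h3⟩ v hv
    exact ⟨isMarking_update h1 hv 0, by rw [numMarked_update_zero hv, h2],
      by rw [numTwo_update_zero hv, h3]⟩
  bd_bd := dMap_dMap

/-- The total complex `(T(G), D)` with `D = d + δ`, filtered by the number of 2-marked vertices: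
`F_q T_n` is spanned by the markings in `T_n` with at least `q` 2-marked vertices. -/
def totalComplex (G : SimpleGraph V) : FilteredComplex ((V → Fin 3) →₀ ℤ) where
  bd := dMap + deltaMap
  chains n := Ttot G n
  bd_mem n x hx := by
    refine Submodule.add_mem _ (relabel_mem ?_ x hx) (relabel_mem ?_ x hx)
    · rintro m ⟨h1, h2⟩ v hv
      refine ⟨isMarking_update h1 hv 0, ?_⟩
      rw [numMarked_update_zero hv, numTwo_update_zero hv]
      omega
    · rintro m ⟨h1, h2⟩ v hv
      refine ⟨isMarking_update h1 hv 2, ?_⟩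
      rw [numMarked_update_two hv, numTwo_update_two hv]
      omega
  bd_bd x := by
    simp only [LinearMap.add_apply, map_add, dMap_dMap, deltaMap_deltaMap, zero_add, add_zero]
    rw [add_comm]
    exact dMap_deltaMap x
  fil q := Finsupp.supported ℤ ℤ {m | q ≤ numTwo m}
  fil_anti q := Finsupp.supported_mono fun m (hm : q + 1 ≤ numTwo m) =>
    show q ≤ numTwo m by omega
  bd_fil q x hx := by
    refine Submodule.add_mem _ (relabel_mem ?_ x hx) (relabel_mem ?_ x hx)
    · intro m hm v hv
      show q ≤ _
      rw [numTwo_update_zero hv]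
      exact hm
    · intro m hm v hv
      show q ≤ _
      rw [numTwo_update_two hv]
      have : q ≤ numTwo m := hm
      omega

end Graph

end IndepSS

end

noncomputable section

namespace IndepSS

/-! The spectral sequence is the classical one, with `E^r = Z^r / B^r` written out inside the
ambient group. Every identification comes from one principle: two surjections from the same group
with the same kernel have isomorphic targets (`exists_linearEquiv_of_surjective`). It is applied to
representatives, so each isomorphism is known on classes and not only abstractly. Beyond that, three
facts about markings carry the theorem.

The first page. `δ` raises the number of 2-marks and `d` preserves it, so modulo `F_{q+1}` only `d`
remains and `E^1` is the homology of the rows (`exists_row_equiv`). On a `d`-cycle `D` equals `δ`,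
hence `d^1 [x] = [δ x]`. A marking with 2-marked set `U` is the same as an independent set of
1-marks outside `N[U]`, and `d` never touches `U`. So the row `q` splits as a sum, over the
independent sets `U` with `q` elements, of augmented chain complexes of `Ind(G - N[U])` shifted by
`q + 1` (`exists_row_homology_equiv`). For `q = 0` only `U = ∅` occurs.

The total homology. Fix a vertex `v` and match the labels 2 and 1 at `v`. Subtracting a boundary
from a cycle removes all markings with label 2 at `v`; the cycle condition then removes those with
label 1, since nothing else can cancel their image with label 2. Treating the vertices one after
another leaves a multiple of the empty marking (`exists_sub_bd_eq_single`). The functional that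
sends a marking without 1-marks to `(-1)^{#2-marks}` and all others to 0 vanishes on boundaries and
is 1 on the empty marking, so `H_0 = ℤ` and the rest vanishes.

The limit. The filtration is bounded, which gives convergence (`converges_of_bounded`). If `I` is
independent, the marking with label 2 on `I` is a cycle of augmentation `±1`, so it generates `H_0`.
Hence `F_q H_0` is all of `H_0` for `q` up to the independence number `α`, and it is zero beyond,
where no markings exist. The only surviving entry is `(α, α)`. -/

/-- Two surjective additive maps with the same kernel have isomorphic targets. -/
theorem exists_linearEquiv_of_surjective {A X Y : Type*} [AddCommGroup A] [AddCommGroup X]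
    [AddCommGroup Y] [Module ℤ X] [Module ℤ Y] (f : A →+ X) (g : A →+ Y)
    (hf : Function.Surjective f) (hg : Function.Surjective g) (h : ∀ a, f a = 0 ↔ g a = 0) :
    ∃ e : X ≃ₗ[ℤ] Y, ∀ a, e (f a) = g a := by
  have hk : f.ker = g.ker := by
    ext a
    exact h a
  let e : X ≃+ Y := (QuotientAddGroup.quotientKerEquivOfSurjective f hf).symm.trans
    ((QuotientAddGroup.quotientAddEquivOfEq hk).trans
      (QuotientAddGroup.quotientKerEquivOfSurjective g hg))
  -- The given `ℤ`-module structures need not be the canonical ones by definition, but each of them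
  -- acts by `zsmul`, so additivity suffices.
  refine ⟨{ e with map_smul' := fun n x => ?_ }, fun a => ?_⟩
  · exact (congrArg e (int_smul_eq_zsmul _ n x)).trans
      ((map_zsmul e n x).trans (int_smul_eq_zsmul _ n (e x)).symm)
  · have : (QuotientAddGroup.quotientKerEquivOfSurjective f hf).symm (f a) = (a : A ⧸ f.ker) := by
      rw [AddEquiv.symm_apply_eq]
      rfl
    change e (f a) = g a
    simp only [e, AddEquiv.trans_apply, this]
    rfl

/-! ### Homology in terms of elements -/

section HomologyElements

variable {κ : Type*} {c : ComplexShape κ} {R : Type*} [Ring R]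
  (K : HomologicalComplex (ModuleCat.{u} R) c)

theorem iCycles_injective (i : κ) : Function.Injective (K.iCycles i).hom :=
  (ModuleCat.mono_iff_injective _).mp inferInstance

theorem d_iCycles (i j : κ) (z : K.cycles i) : (K.d i j).hom ((K.iCycles i).hom z) = 0 :=
  LinearMap.congr_fun (congrArg ModuleCat.Hom.hom (K.iCycles_d i j)) z

theorem homologyπ_surjective (i : κ) : Function.Surjective (K.homologyπ i).hom :=
  (ModuleCat.epi_iff_surjective _).mp inferInstance

/-- Homology is the cokernel of `toCycles`, so exactness at the cycles produces the preimage. -/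
theorem homologyπ_eq_zero_iff {i j : κ} (hi : c.prev j = i) (z : K.cycles j) :
    (K.homologyπ j).hom z = 0 ↔ ∃ y : K.X i, (K.d i j).hom y = (K.iCycles j).hom z := by
  have hcomp (y : K.X i) : (K.iCycles j).hom ((K.toCycles i j).hom y) = (K.d i j).hom y :=
    LinearMap.congr_fun (congrArg ModuleCat.Hom.hom (K.toCycles_i i j)) y
  constructor
  · intro hz
    have hex : (ShortComplex.mk (K.toCycles i j) (K.homologyπ j) (by simp)).Exact :=
      ShortComplex.exact_of_g_is_cokernel _ (K.homologyIsCokernel i j hi)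
    obtain ⟨y, hy⟩ := (ShortComplex.moduleCat_exact_iff _).mp hex z hz
    exact ⟨y, by rw [← hcomp]; exact congrArg _ hy⟩
  · rintro ⟨y, hy⟩
    rw [← hcomp] at hy
    rw [← iCycles_injective K j hy]
    exact LinearMap.congr_fun (congrArg ModuleCat.Hom.hom (K.toCycles_comp_homologyπ i j)) y

end HomologyElements

namespace SubComplex

variable {M : Type u} [AddCommGroup M] (C : SubComplex M)

/-- The element of `M` underlying an element of a chain group of `C.toChainComplex`. -/
def val {n : ℤ} (x : C.toChainComplex.X n) : M := Subtype.val (p := (· ∈ C.chains n)) x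

theorem val_mem {n : ℤ} (x : C.toChainComplex.X n) : C.val x ∈ C.chains n :=
  Subtype.property (p := (· ∈ C.chains n)) x

theorem val_injective {n : ℤ} : Function.Injective (C.val (n := n)) :=
  Subtype.val_injective (p := (· ∈ C.chains n))

theorem val_d {i j : ℤ} (h : j + 1 = i) (x : C.toChainComplex.X i) :
    C.val ((C.toChainComplex.d i j).hom x) = C.bd (C.val x) := by
  simp only [toChainComplex, dif_pos h]
  rfl

/-- Bridge between `cls`, defined by a categorical lift, and representatives in `M`; surjectivity
and the kernel of `cls` are both read off from it. -/
theorem exists_cls_eq {n : ℤ} (x : C.cyc n) : ∃ z : C.toChainComplex.cycles n,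
    C.val ((C.toChainComplex.iCycles n).hom z) = x ∧
      (C.toChainComplex.homologyπ n).hom z = C.cls n x := by
  let k : ModuleCat.of ℤ (C.cyc n) ⟶ C.toChainComplex.X n :=
    ModuleCat.ofHom (Submodule.inclusion (inf_le_left : C.cyc n ≤ C.chains n))
  have hk : k ≫ C.toChainComplex.d n (n - 1) = 0 := by
    ext x
    refine C.val_injective ?_
    exact (C.val_d (sub_add_cancel n 1) _).trans x.2.2
  have hn : (ComplexShape.down ℤ).next n = n - 1 := (ComplexShape.down ℤ).next_eq' (by simp)
  refine ⟨(C.toChainComplex.liftCycles k (n - 1) hn hk).hom x, ?_, rfl⟩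
  exact congrArg C.val (LinearMap.congr_fun (congrArg ModuleCat.Hom.hom
    (C.toChainComplex.liftCycles_i k _ hn hk)) x)

theorem cls_surjective (n : ℤ) : Function.Surjective (C.cls n) := by
  intro h
  obtain ⟨z, rfl⟩ := homologyπ_surjective _ _ h
  set x := (C.toChainComplex.iCycles n).hom z with hx
  have hxd : C.bd (C.val x) = 0 := by
    rw [← C.val_d (sub_add_cancel n 1), hx, d_iCycles]
    rfl
  obtain ⟨z', hz', h'⟩ := C.exists_cls_eq ⟨C.val x, C.val_mem x, hxd⟩
  refine ⟨_, h'.symm.trans (congrArg _ (iCycles_injective _ _ (C.val_injective hz')))⟩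

theorem cls_eq_zero_iff {n : ℤ} (x : C.cyc n) :
    C.cls n x = 0 ↔ ∃ y ∈ C.chains (n + 1), C.bd y = x := by
  obtain ⟨z, hz, h⟩ := C.exists_cls_eq x
  have hn : (ComplexShape.down ℤ).prev n = n + 1 := (ComplexShape.down ℤ).prev_eq' (by simp)
  rw [← h, homologyπ_eq_zero_iff C.toChainComplex hn]
  constructor
  · rintro ⟨y, hy⟩
    exact ⟨C.val y, C.val_mem y, by rw [← C.val_d rfl, hy, hz]⟩
  · rintro ⟨y, hy, h⟩
    refine ⟨(⟨y, hy⟩ : C.chains (n + 1)), C.val_injective ?_⟩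
    rw [hz]
    exact (C.val_d rfl _).trans h

theorem cls_eq_cls_iff {n : ℤ} (x y : C.cyc n) :
    C.cls n x = C.cls n y ↔ ∃ z ∈ C.chains (n + 1), C.bd z = (x : M) - y := by
  rw [← sub_eq_zero, ← map_sub, cls_eq_zero_iff]
  rfl

end SubComplex

/-! ### Subquotients -/

theorem subquotientMk_surjective {R : Type} [Ring R] {N : Type u} [AddCommGroup N] [Module R N]
    (A B : Submodule R N) (y : subquotient A B) : ∃ x hx, subquotientMk A B x hx = y := by
  obtain ⟨x, rfl⟩ := (B.submoduleOf A).mkQ_surjective y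
  exact ⟨x, x.2, rfl⟩

theorem subquotientMk_eq_zero_iff {R : Type} [Ring R] {N : Type u} [AddCommGroup N] [Module R N]
    {A B : Submodule R N} {x : N} (hx : x ∈ A) : subquotientMk A B x hx = 0 ↔ x ∈ B :=
  Submodule.Quotient.mk_eq_zero _

/-- The projection `A → A / (A ⊓ B)` as a linear map. -/
def subquotientProj {R : Type} [Ring R] {N : Type u} [AddCommGroup N] [Module R N]
    (A B : Submodule R N) : A →ₗ[R] subquotient A B :=
  (B.submoduleOf A).mkQ

theorem subquotientProj_surjective {R : Type} [Ring R] {N : Type u} [AddCommGroup N] [Module R N]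
    (A B : Submodule R N) : Function.Surjective (subquotientProj A B) :=
  (B.submoduleOf A).mkQ_surjective

theorem subquotientProj_eq_zero_iff {R : Type} [Ring R] {N : Type u} [AddCommGroup N]
    [Module R N] {A B : Submodule R N} (x : A) : subquotientProj A B x = 0 ↔ (x : N) ∈ B :=
  Submodule.Quotient.mk_eq_zero _

/-- The map between subquotients that is induced by a linear map. -/
def subquotientMap {R : Type} [Ring R] {N : Type u} [AddCommGroup N] [Module R N]
    {A B A' B' : Submodule R N} (f : N →ₗ[R] N) (hA : ∀ x ∈ A, f x ∈ A')
    (hB : ∀ x ∈ B, f x ∈ B') : subquotient A B ⟶ subquotient A' B' :=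
  ModuleCat.ofHom (Submodule.mapQ (B.submoduleOf A) (B'.submoduleOf A') (f.restrict hA)
    fun x hx => hB x hx)

/-! ### Construction of the spectral sequence of a filtered complex -/

namespace FilteredComplex

variable {M : Type u} [AddCommGroup M] (C : FilteredComplex M)

theorem bd_bd_mem (x : M) (N : Submodule ℤ M) : C.bd (C.bd x) ∈ N := by
  rw [C.bd_bd]
  exact zero_mem _

theorem mem_approxBoundaries {r p q : ℤ} {x : M} :
    x ∈ C.approxBoundaries r p q ↔ ∃ a ∈ C.approxCycles (r - 1) (p + 1) (q + 1),
      ∃ b ∈ C.approxCycles (r - 1) (p - r + 2) (q - r + 1), a + C.bd b = x := by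
  simp [approxBoundaries, Submodule.mem_sup]

theorem approxCycles_succ_le (r p q : ℤ) : C.approxCycles (r + 1) p q ≤ C.approxCycles r p q := by
  rintro x ⟨⟨h1, h2⟩, h3⟩
  refine ⟨⟨h1, h2⟩, C.fil_anti _ ?_⟩
  rw [add_assoc]
  exact h3

theorem approxCycles_shift_le {r r' p p' q q' : ℤ} (hr : r' = r - 1) (hp : p' = p + 1)
    (hq : q' = q + 1) : C.approxCycles r' p' q' ≤ C.approxCycles r p q := by
  subst hr hp hq
  rintro x ⟨⟨h1, h2⟩, h3⟩
  refine ⟨⟨?_, C.fil_anti _ h2⟩, ?_⟩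
  · rwa [show p - q = p + 1 - (q + 1) by ring]
  · change C.bd x ∈ C.fil (q + r)
    rwa [show q + r = q + 1 + (r - 1) by ring]

theorem bd_mem_approxCycles {r p q p' q' : ℤ} (hp : p' = p + (r - 1)) (hq : q' = q + r) {x : M}
    (hx : x ∈ C.approxCycles r p q) : C.bd x ∈ C.approxCycles r p' q' := by
  subst hp hq
  obtain ⟨⟨h1, h2⟩, h3⟩ := hx
  refine ⟨⟨?_, h3⟩, ?_⟩
  · rw [show p + (r - 1) - (q + r) = p - q - 1 by ring]
    exact C.bd_mem _ _ h1
  · exact C.bd_bd_mem _ _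

/-- Since `D(a + D b) = D a`, only the first summand of the source matters, and `D` carries it into
the second summand of the target. -/
theorem bd_mem_approxBoundaries {r p q p' q' : ℤ} (hp : p' = p + (r - 1)) (hq : q' = q + r)
    {x : M} (hx : x ∈ C.approxBoundaries r p q) : C.bd x ∈ C.approxBoundaries r p' q' := by
  subst hp hq
  obtain ⟨a, ha, b, hb, rfl⟩ := C.mem_approxBoundaries.mp hx
  refine C.mem_approxBoundaries.mpr ⟨0, zero_mem _, a, ?_, ?_⟩
  · rwa [show p + (r - 1) - r + 2 = p + 1 by ring, show q + r - r + 1 = q + 1 by ring]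
  · rw [map_add, C.bd_bd, zero_add, add_zero]

/-- The entry `E^r_{p,q}` of the spectral sequence of `C`. -/
abbrev entry (r : ℤ) (i : ℤ × ℤ) : ModuleCat.{u} ℤ :=
  subquotient (C.approxCycles r i.1 i.2) (C.approxBoundaries r i.1 i.2)

/-- The differential `d^r`. -/
def entryD (r : ℤ) (i j : ℤ × ℤ) (h : i + (r - 1, r) = j) : C.entry r i ⟶ C.entry r j :=
  subquotientMap C.bd
    (fun _ hx => C.bd_mem_approxCycles (congrArg Prod.fst h).symm (congrArg Prod.snd h).symm hx)
    (fun _ hx => C.bd_mem_approxBoundaries (congrArg Prod.fst h).symm (congrArg Prod.snd h).symm hx)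

/-- The `r`-th page of the spectral sequence of `C`. -/
def page (r : ℤ) : HomologicalComplex (ModuleCat.{u} ℤ) (pageShape r) where
  X i := C.entry r i
  d i j := if h : i + (r - 1, r) = j then C.entryD r i j h else 0
  shape i j h := dif_neg h
  d_comp_d' i j k hij hjk := by
    have h1 : i + (r - 1, r) = j := hij
    have h2 : j + (r - 1, r) = k := hjk
    rw [dif_pos h1, dif_pos h2]
    ext x
    obtain ⟨x, rfl⟩ := subquotientProj_surjective _ _ x
    refine (subquotientProj_eq_zero_iff _).mpr ?_
    exact C.bd_bd_mem _ _

/-- The projection `Z^r_{p,q} → E^r_{p,q}`. -/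
def pageProj (r : ℤ) (i : ℤ × ℤ) : C.approxCycles r i.1 i.2 →ₗ[ℤ] (C.page r).X i :=
  subquotientProj (C.approxCycles r i.1 i.2) (C.approxBoundaries r i.1 i.2)

theorem pageProj_surjective (r : ℤ) (i : ℤ × ℤ) : Function.Surjective (C.pageProj r i) :=
  subquotientProj_surjective _ _

theorem pageProj_eq_zero_iff (r : ℤ) (i : ℤ × ℤ) (x : C.approxCycles r i.1 i.2) :
    C.pageProj r i x = 0 ↔ (x : M) ∈ C.approxBoundaries r i.1 i.2 :=
  subquotientProj_eq_zero_iff _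

theorem pageProj_eq_iff (r : ℤ) (i : ℤ × ℤ) (x y : C.approxCycles r i.1 i.2) :
    C.pageProj r i x = C.pageProj r i y ↔ (x : M) - y ∈ C.approxBoundaries r i.1 i.2 := by
  rw [← sub_eq_zero, ← map_sub, pageProj_eq_zero_iff]
  rfl

theorem page_d_proj (r : ℤ) (i j : ℤ × ℤ) (h : i + (r - 1, r) = j)
    (x : C.approxCycles r i.1 i.2) :
    ((C.page r).d i j).hom (C.pageProj r i x) = C.pageProj r j ⟨C.bd x,
      C.bd_mem_approxCycles (congrArg Prod.fst h).symm (congrArg Prod.snd h).symm x.2⟩ := by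
  have : (C.page r).d i j = C.entryD r i j h := dif_pos h
  rw [this]
  rfl

theorem pageShape_next (r : ℤ) (i : ℤ × ℤ) : (pageShape r).next i = i + (r - 1, r) :=
  (pageShape r).next_eq' rfl

theorem pageShape_prev (r : ℤ) (i : ℤ × ℤ) : (pageShape r).prev i = i - (r - 1, r) :=
  (pageShape r).prev_eq' (sub_add_cancel i _)

/-- The inclusion `Z^{r+1}_{p,q} → Z^r_{p,q}` followed by the projection to `E^r_{p,q}`. -/
def succProj (r : ℤ) (i : ℤ × ℤ) :
    ModuleCat.of ℤ (C.approxCycles (r + 1) i.1 i.2) ⟶ (C.page r).X i :=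
  ModuleCat.ofHom (C.pageProj r i ∘ₗ Submodule.inclusion (C.approxCycles_succ_le r i.1 i.2))

/-- For `x` in `Z^{r+1}` the boundary lies one filtration step deeper than `d^r` requires, so it
falls in the first summand of the approximate boundaries. -/
theorem succProj_d (r : ℤ) (i : ℤ × ℤ) :
    C.succProj r i ≫ (C.page r).d i (i + (r - 1, r)) = 0 := by
  ext x
  refine (C.page_d_proj r i _ rfl _).trans ((C.pageProj_eq_zero_iff _ _ _).mpr ?_)
  refine C.mem_approxBoundaries.mpr ⟨C.bd x, ⟨⟨?_, ?_⟩, ?_⟩, 0, zero_mem _, by simp⟩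
  · have := C.bd_mem _ _ x.2.1.1
    rwa [show (i + (r - 1, r)).1 + 1 - ((i + (r - 1, r)).2 + 1) = i.1 - i.2 - 1 by
      simp only [Prod.fst_add, Prod.snd_add]; ring]
  · have := x.2.2
    rwa [show (i + (r - 1, r)).2 + 1 = i.2 + (r + 1) by simp only [Prod.snd_add]; ring]
  · exact C.bd_bd_mem _ _

/-- The map that sends an element of `Z^{r+1}_{p,q}` to the cycle of `E^r_{p,q}` that it
represents. -/
def toPageCycles (r : ℤ) (i : ℤ × ℤ) :
    ModuleCat.of ℤ (C.approxCycles (r + 1) i.1 i.2) ⟶ (C.page r).cycles i :=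
  (C.page r).liftCycles (C.succProj r i) _ (pageShape_next r i) (C.succProj_d r i)

theorem iCycles_toPageCycles (r : ℤ) (i : ℤ × ℤ) (x : C.approxCycles (r + 1) i.1 i.2) :
    ((C.page r).iCycles i).hom ((C.toPageCycles r i).hom x) =
      C.pageProj r i ⟨x, C.approxCycles_succ_le r i.1 i.2 x.2⟩ :=
  LinearMap.congr_fun (congrArg ModuleCat.Hom.hom ((C.page r).liftCycles_i (C.succProj r i) _
    (pageShape_next r i) (C.succProj_d r i))) x

/-- The map that sends an element of `Z^{r+1}_{p,q}` to its class in the homology of the `r`-th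
page. -/
def toPageHomology (r : ℤ) (i : ℤ × ℤ) :
    C.approxCycles (r + 1) i.1 i.2 →ₗ[ℤ] (C.page r).homology i :=
  ((C.page r).homologyπ i).hom ∘ₗ (C.toPageCycles r i).hom

/-- If `d^r [z] = 0`, then `D z = a + D b` with `a` one filtration step deeper. Correcting `z` by
`b` gives an element of `Z^{r+1}`, and `b` represents zero on the page, so the class is unchanged.
-/
theorem toPageHomology_surjective (r : ℤ) (i : ℤ × ℤ) :
    Function.Surjective (C.toPageHomology r i) := by
  intro h
  obtain ⟨c, rfl⟩ := homologyπ_surjective _ _ h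
  obtain ⟨z, hz⟩ := C.pageProj_surjective r i (((C.page r).iCycles i).hom c)
  have hd := d_iCycles (C.page r) i (i + (r - 1, r)) c
  rw [← hz, C.page_d_proj r i _ rfl, pageProj_eq_zero_iff] at hd
  obtain ⟨a, ha, b, hb, hab : a + C.bd b = C.bd z⟩ := C.mem_approxBoundaries.mp hd
  have hb' : b ∈ C.approxCycles (r - 1) (i.1 + 1) (i.2 + 1) := by
    rwa [show (i + (r - 1, r)).1 - r + 2 = i.1 + 1 by simp only [Prod.fst_add]; ring,
      show (i + (r - 1, r)).2 - r + 1 = i.2 + 1 by simp only [Prod.snd_add]; ring] at hb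
  have hzb : (z : M) - b ∈ C.approxCycles (r + 1) i.1 i.2 := by
    have := sub_mem z.2 (C.approxCycles_shift_le rfl rfl rfl hb')
    refine ⟨this.1, ?_⟩
    change C.bd (z - b) ∈ C.fil (i.2 + (r + 1))
    rw [map_sub, ← hab, add_sub_cancel_right, ← add_assoc]
    exact ha.1.2
  refine ⟨⟨z - b, hzb⟩, congrArg ((C.page r).homologyπ i).hom (iCycles_injective _ _ ?_)⟩
  rw [iCycles_toPageCycles, ← hz, pageProj_eq_iff]
  refine C.mem_approxBoundaries.mpr ⟨-b, neg_mem hb', 0, zero_mem _, ?_⟩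
  change -b + C.bd 0 = (z : M) - b - z
  rw [map_zero]
  abel

/-- If `[x] = d^r [y]`, then `x = -a + D(y - b)` with `a` and `b` taken from an approximate
boundary. -/
theorem toPageHomology_eq_zero_iff (r : ℤ) (i : ℤ × ℤ) (x : C.approxCycles (r + 1) i.1 i.2) :
    C.toPageHomology r i x = 0 ↔ (x : M) ∈ C.approxBoundaries (r + 1) i.1 i.2 := by
  refine (homologyπ_eq_zero_iff (C.page r) (pageShape_prev r i) _).trans ?_
  rw [iCycles_toPageCycles, mem_approxBoundaries]
  have h1 : i.1 - (r + 1) + 2 = (i - (r - 1, r)).1 := by simp only [Prod.fst_sub]; ring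
  have h2 : i.2 - (r + 1) + 1 = (i - (r - 1, r)).2 := by simp only [Prod.snd_sub]; ring
  rw [h1, h2, add_sub_cancel_right]
  constructor
  · rintro ⟨y, hy⟩
    obtain ⟨y, rfl⟩ := C.pageProj_surjective r _ y
    rw [C.page_d_proj r _ _ (sub_add_cancel i _), pageProj_eq_iff] at hy
    obtain ⟨a, ha, b, hb, hab : a + C.bd b = C.bd y - x⟩ := C.mem_approxBoundaries.mp hy
    have hx : (x : M) = -a + C.bd (y - b) := by
      rw [← sub_sub_cancel (C.bd y) (x : M), ← hab, map_sub]
      abel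
    -- A priori `a` lies only in `Z^{r-1}`, but `D(-a) = D x` and `x` is in `Z^{r+1}`, which gives
    -- the extra filtration step needed for `Z^r`.
    have ha' : C.bd (-a) ∈ C.fil (i.2 + 1 + r) := by
      have h := congrArg C.bd hx
      rw [map_add, C.bd_bd, add_zero] at h
      rw [← h, add_assoc, add_comm 1 r]
      exact x.2.2
    refine ⟨-a, ⟨(neg_mem ha).1, ha'⟩, y - b, sub_mem y.2 ?_, hx.symm⟩
    · refine C.approxCycles_shift_le rfl ?_ ?_ hb
      · simp only [Prod.fst_sub]
        ring
      · rfl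
  · rintro ⟨a, ha, b, hb, hab⟩
    refine ⟨C.pageProj r _ ⟨b, hb⟩, ?_⟩
    rw [C.page_d_proj r _ _ (sub_add_cancel i _), pageProj_eq_iff, mem_approxBoundaries]
    have ha' : a ∈ C.approxCycles (r - 1) (i.1 + 1) (i.2 + 1) :=
      C.approxCycles_succ_le _ _ _ (by rwa [sub_add_cancel])
    refine ⟨-a, neg_mem ha', 0, zero_mem _, ?_⟩
    change _ = C.bd b - x
    rw [← hab, map_zero]
    abel

theorem exists_homology_equiv (r : ℤ) (i : ℤ × ℤ) :
    ∃ e : (C.page r).homology i ≃ₗ[ℤ] (C.page (r + 1)).X i,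
      ∀ x, e (C.toPageHomology r i x) = C.pageProj (r + 1) i x := by
  obtain ⟨e, he⟩ := exists_linearEquiv_of_surjective (C.toPageHomology r i).toAddMonoidHom
    (C.pageProj (r + 1) i).toAddMonoidHom (C.toPageHomology_surjective r i)
    (C.pageProj_surjective (r + 1) i) fun x =>
      (C.toPageHomology_eq_zero_iff r i x).trans (C.pageProj_eq_zero_iff (r + 1) i x).symm
  exact ⟨e, he⟩

/-- The isomorphism between the homology of the `r`-th page and the next page. -/
def pageIso (r r' : ℤ) (i : ℤ × ℤ) (h : r + 1 = r') :
    (C.page r).homology i ≅ (C.page r').X i :=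
  (C.exists_homology_equiv r i).choose.toModuleIso ≪≫ eqToIso (by rw [h])

/-- The spectral sequence of a filtered complex. -/
def spectralSequence : SpectralSequence (ModuleCat.{u} ℤ) pageShape 0 where
  page r _ := C.page r
  iso r r' i h _ := C.pageIso r r' i h

/-- The identification of the pages of `C.spectralSequence`. -/
def spectralSequenceData : C.SpectralSequenceData C.spectralSequence where
  proj r _ p q := C.pageProj r (p, q)
  proj_surjective r _ p q := C.pageProj_surjective r (p, q)
  proj_eq_zero_iff r _ p q := C.pageProj_eq_zero_iff r (p, q)
  d_proj r _ p q x := ⟨C.bd_mem_approxCycles rfl rfl x.2, C.page_d_proj r (p, q) _ rfl x⟩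
  iso_proj r _ _ p q x := by
    refine ⟨C.approxCycles_succ_le r p q x.2, (C.toPageCycles r (p, q)).hom x,
      C.iCycles_toPageCycles r (p, q) x, ?_⟩
    refine Eq.trans ?_ ((C.exists_homology_equiv r (p, q)).choose_spec x)
    change (C.pageIso r (r + 1) (p, q) rfl).hom.hom _ = _
    simp only [pageIso, eqToIso_refl, Iso.trans_refl]
    rfl

/-! ### Convergence for a bounded filtration -/

variable {C}

theorem mem_homologyFil {q n : ℤ} {y : C.homology n} :
    y ∈ C.homologyFil q n ↔ ∃ x : C.cyc n, (x : M) ∈ C.fil q ∧ C.cls n x = y := Iff.rfl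

/-- The cycles of degree `n` in the `q`-th step of the filtration. -/
abbrev filCyc (C : FilteredComplex M) (q n : ℤ) : Submodule ℤ M := C.cyc n ⊓ C.fil q

theorem filCyc_le_approxCycles (r p q : ℤ) : C.filCyc q (p - q) ≤ C.approxCycles r p q := by
  rintro x ⟨⟨h1, h2⟩, h3⟩
  refine ⟨⟨h1, h3⟩, ?_⟩
  change C.bd x ∈ C.fil (q + r)
  rw [LinearMap.mem_ker.mp h2]
  exact zero_mem _

/-- The map that sends a cycle in `F_q C_n` to its class in `F_q H_n`. -/
def toHomologyFil (C : FilteredComplex M) (q n : ℤ) : C.filCyc q n →+ C.homologyFil q n where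
  toFun x := ⟨C.cls n ⟨x, x.2.1⟩, ⟨x, x.2.1⟩, x.2.2, rfl⟩
  map_zero' := Subtype.ext (map_zero (C.cls n))
  map_add' x y := Subtype.ext (map_add (C.cls n) ⟨x, x.2.1⟩ ⟨y, y.2.1⟩)

theorem toHomologyFil_surjective (q n : ℤ) : Function.Surjective (C.toHomologyFil q n) := by
  rintro ⟨_, x, hx, rfl⟩
  exact ⟨⟨x, x.2, hx⟩, rfl⟩

namespace SpectralSequenceData

variable {E : SpectralSequence (ModuleCat.{u} ℤ) pageShape 0}

theorem subsingleton_of_le (R : C.SpectralSequenceData E)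
    {r : ℤ} (hr : 0 ≤ r) {p q : ℤ}
    (h : C.approxCycles r p q ≤ C.approxBoundaries r p q) :
    Subsingleton ((E.page r hr).X (p, q)) := by
  refine subsingleton_of_forall_eq 0 fun y => ?_
  obtain ⟨x, rfl⟩ := R.proj_surjective r hr p q y
  exact (R.proj_eq_zero_iff r hr p q x).mpr (h x.2)

/-- When the filtration does not jump at `q`, all of `Z^r_{p,q}` lies in `Z^{r-1}_{p+1,q+1}`, the
first summand of the approximate boundaries. -/
theorem subsingleton_of_fil_eq (R : C.SpectralSequenceData E)
    {r : ℤ} (hr : 0 ≤ r) {p q : ℤ} (h : C.fil (q + 1) = C.fil q) :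
    Subsingleton ((E.page r hr).X (p, q)) := by
  refine R.subsingleton_of_le hr (le_trans ?_ le_sup_left)
  rintro x ⟨⟨h1, h2⟩, h3⟩
  refine ⟨⟨?_, ?_⟩, ?_⟩
  · rwa [show p + 1 - (q + 1) = p - q by ring]
  · exact h ▸ h2
  · change C.bd x ∈ C.fil (q + 1 + (r - 1))
    rwa [show q + 1 + (r - 1) = q + r by ring]

/-- Allows target indices that agree with `(p + (r - 1), q + r)` only propositionally, such as `(p,
q + 1)` for `r = 1`. -/
theorem d_proj_of_eq (R : C.SpectralSequenceData E)
    {r : ℤ} (hr : 0 ≤ r) {p q p' q' : ℤ} (hp : p' = p + (r - 1))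
    (hq : q' = q + r) (x : C.approxCycles r p q) :
    ∃ h : C.bd x ∈ C.approxCycles r p' q',
      ((E.page r hr).d (p, q) (p', q')).hom (R.proj r hr p q x) =
        R.proj r hr p' q' ⟨C.bd x, h⟩ := by
  subst hp hq
  exact R.d_proj r hr p q x

/-- The spectral sequence of a bounded filtration converges. -/
theorem converges_of_bounded (R : C.SpectralSequenceData E)
    {N : ℤ} (h0 : ∀ q ≤ 0, C.fil q = ⊤) (hN : ∀ q, N < q → C.fil q = ⊥) :
    R.Converges := by
  constructor
  · refine ⟨0, N + 1, fun n => ⟨eq_top_iff.mpr fun y _ => ?_, eq_bot_iff.mpr fun y hy => ?_⟩⟩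
    · obtain ⟨x, rfl⟩ := C.cls_surjective n y
      exact ⟨x, by simp [h0 0 le_rfl], rfl⟩
    · obtain ⟨x, hx, rfl⟩ := mem_homologyFil.mp hy
      rw [hN _ (lt_add_one N)] at hx
      obtain rfl : x = 0 := Subtype.ext hx
      simp
  -- Such an `r` exceeds the length of the filtration: a differential starting at `q < 0` has zero
  -- source, and one starting at `q ≥ 0` ends above `N`, where the entries vanish.
  refine ⟨N + 2, fun r hr hrN => ⟨?_, fun p q => ?_⟩⟩
  · rintro ⟨p, q⟩ ⟨p', q'⟩
    by_cases hrel : (pageShape r).Rel (p, q) (p', q')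
    swap
    · exact (E.page r hr).shape _ _ hrel
    have hq' : q + r = q' := congrArg Prod.snd hrel
    ext x
    rcases lt_or_ge q 0 with hq | hq
    · have := R.subsingleton_of_fil_eq hr (p := p) (q := q) (by rw [h0 _ hq, h0 _ hq.le])
      rw [Subsingleton.elim x 0, map_zero, map_zero]
    · have := R.subsingleton_of_fil_eq hr (p := p') (q := q')
        (by rw [hN _ (by omega), hN _ (by omega)])
      exact Subsingleton.elim _ _
  · let f := (R.proj r hr p q).toAddMonoidHom.comp
      (Submodule.inclusion (filCyc_le_approxCycles r p q)).toAddMonoidHom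
    let g := (subquotientProj (C.homologyFil q (p - q))
      (C.homologyFil (q + 1) (p - q))).toAddMonoidHom.comp (C.toHomologyFil q (p - q))
    have hf : Function.Surjective f := by
      intro y
      obtain ⟨x, rfl⟩ := R.proj_surjective r hr p q y
      rcases lt_or_ge q 0 with hq | hq
      · have := R.subsingleton_of_fil_eq hr (p := p) (q := q) (by rw [h0 _ hq, h0 _ hq.le])
        exact ⟨0, Subsingleton.elim _ _⟩
      -- Here `q + r > N`, so a boundary in `F_{q+r}` is zero and an approximate cycle is a genuine
      -- one.
      · refine ⟨⟨x, ⟨x.2.1.1, ?_⟩, x.2.1.2⟩, rfl⟩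
        have := x.2.2
        rw [hN _ (by omega)] at this
        exact this
    have hg : Function.Surjective g :=
      (subquotientProj_surjective _ _).comp (toHomologyFil_surjective _ _)
    have hfg (x) : f x = 0 ↔ g x = 0 := by
      refine (R.proj_eq_zero_iff r hr p q _).trans
        (Iff.trans ?_ (subquotientProj_eq_zero_iff _).symm)
      change (x : M) ∈ _ ↔ C.cls (p - q) ⟨x, x.2.1⟩ ∈ _
      rw [mem_homologyFil, mem_approxBoundaries]
      constructor
      · rintro ⟨a, ha, b, hb, hab⟩
        -- Because `x` is a cycle and `x = a + D b`, also `a` is a cycle; it represents the class of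
        -- `x` one filtration step deeper.
        have hd : C.bd a = 0 := by
          have h := congrArg C.bd hab
          rwa [map_add, C.bd_bd, add_zero, LinearMap.mem_ker.mp x.2.1.2] at h
        have ha1 := ha.1.1
        rw [show p + 1 - (q + 1) = p - q by ring] at ha1
        refine ⟨⟨a, ha1, hd⟩, ha.1.2, (C.cls_eq_cls_iff _ _).mpr ⟨-b, neg_mem ?_, ?_⟩⟩
        · have := hb.1.1
          rwa [show p - r + 2 - (q - r + 1) = p - q + 1 by ring] at this
        · change C.bd (-b) = a - x
          rw [map_neg, ← hab]
          abel
      · rintro ⟨a, ha, hax⟩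
        obtain ⟨b, hb, hba⟩ := (C.cls_eq_cls_iff _ _).mp hax
        change C.bd b = a - x at hba
        have ha' : (a : M) ∈ C.approxCycles (r - 1) (p + 1) (q + 1) := by
          refine filCyc_le_approxCycles _ _ _ ⟨?_, ha⟩
          rw [show p + 1 - (q + 1) = p - q by ring]
          exact a.2
        -- For `q > N` the element `x` is itself zero. For `q ≤ N` the index `q - r + 1` is at most
        -- 0, so membership of `b` in that filtration step is no condition.
        rcases lt_or_ge N q with hq | hq
        · have : (x : M) = 0 := by simpa [hN q hq] using x.2.2
          exact ⟨0, zero_mem _, 0, zero_mem _, by simp [this]⟩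
        refine ⟨a, ha', -b, neg_mem ⟨⟨?_, ?_⟩, ?_⟩, ?_⟩
        · rwa [show p - r + 2 - (q - r + 1) = p - q + 1 by ring]
        · simp [h0 (q - r + 1) (by omega)]
        · change C.bd b ∈ C.fil (q - r + 1 + (r - 1))
          rw [hba, show q - r + 1 + (r - 1) = q by ring]
          exact sub_mem (C.fil_anti _ ha) x.2.2
        · rw [map_neg, hba]
          abel
    obtain ⟨e, he⟩ := exists_linearEquiv_of_surjective f g hf hg hfg
    exact ⟨e, fun x hx => ⟨filCyc_le_approxCycles r p q ⟨x.2, hx⟩, ⟨x, hx, rfl⟩,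
      he ⟨x, x.2, hx⟩⟩⟩

end SpectralSequenceData

end FilteredComplex

/-! ### The first page as the homology of the rows -/

section Graph

theorem mem_T {V : Type u} [Fintype V] {G : SimpleGraph V} {i j : ℤ} {x : (V → Fin 3) →₀ ℤ} :
    x ∈ T G i j ↔ ∀ m, x m ≠ 0 → IsMarking G m ∧ numMarked m = i ∧ numTwo m = j := by
  simp [T, Finsupp.mem_supported, Set.subset_def]

variable {V : Type u} [Fintype V] [LinearOrder V] {G : SimpleGraph V}

theorem totalComplex_bd (x : (V → Fin 3) →₀ ℤ) :
    (totalComplex G).bd x = dMap x + deltaMap x := rfl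

theorem mem_totalComplex_chains {n : ℤ} {x : (V → Fin 3) →₀ ℤ} :
    x ∈ (totalComplex G).chains n ↔
      ∀ m, x m ≠ 0 → IsMarking G m ∧ numMarked m - numTwo m = n := by
  simp [totalComplex, Ttot, Finsupp.mem_supported, Set.subset_def]

theorem mem_totalComplex_fil {q : ℤ} {x : (V → Fin 3) →₀ ℤ} :
    x ∈ (totalComplex G).fil q ↔ ∀ m, x m ≠ 0 → q ≤ numTwo m := by
  simp [totalComplex, Finsupp.mem_supported, Set.subset_def]

theorem deltaMap_mem_fil {q : ℤ} {x : (V → Fin 3) →₀ ℤ} (hx : x ∈ (totalComplex G).fil q) :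
    deltaMap x ∈ (totalComplex G).fil (q + 1) := by
  refine relabel_mem (fun m (hm : q ≤ _) v hv => ?_) x hx
  change q + 1 ≤ _
  rw [numTwo_update_two hv]
  omega

theorem deltaMap_mem_T {p q : ℤ} {x : (V → Fin 3) →₀ ℤ} (hx : x ∈ T G p q) :
    deltaMap x ∈ T G p (q + 1) := by
  refine relabel_mem ?_ x hx
  rintro m ⟨h1, h2, h3⟩ v hv
  exact ⟨isMarking_update h1 hv 2, by rw [numMarked_update_two hv, h2],
    by rw [numTwo_update_two hv, h3]⟩

theorem mem_chains_of_mem_T {p q : ℤ} {x : (V → Fin 3) →₀ ℤ} (hx : x ∈ T G p q) :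
    x ∈ (totalComplex G).chains (p - q) := by
  rw [mem_totalComplex_chains]
  intro m hm
  obtain ⟨h1, h2, h3⟩ := mem_T.mp hx m hm
  exact ⟨h1, by rw [h2, h3]⟩

theorem mem_fil_of_mem_T {p q : ℤ} {x : (V → Fin 3) →₀ ℤ} (hx : x ∈ T G p q) :
    x ∈ (totalComplex G).fil q := by
  rw [mem_totalComplex_fil]
  intro m hm
  exact (mem_T.mp hx m hm).2.2.ge

theorem eq_zero_of_mem_T_of_mem_fil {p q : ℤ} {x : (V → Fin 3) →₀ ℤ} (hx : x ∈ T G p q)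
    (hx' : x ∈ (totalComplex G).fil (q + 1)) : x = 0 := by
  ext m
  by_contra hm
  have h1 := (mem_T.mp hx m hm).2.2
  have h2 := mem_totalComplex_fil.mp hx' m hm
  omega

/-- An element of `F_q T_{p-q}` is the sum of an element of `T_{p,q}` and one of
`F_{q+1} T_{p-q}`. -/
theorem exists_mem_T_sub_mem_fil {p q : ℤ} {x : (V → Fin 3) →₀ ℤ}
    (hx : x ∈ (totalComplex G).chains (p - q)) (hx' : x ∈ (totalComplex G).fil q) :
    ∃ y ∈ T G p q, x - y ∈ (totalComplex G).chains (p - q) ∧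
      x - y ∈ (totalComplex G).fil (q + 1) := by
  have hy : x.filter (fun m => numTwo m = q) ∈ T G p q := by
    rw [mem_T]
    intro m hm
    rw [Finsupp.filter_apply, ite_ne_right_iff] at hm
    obtain ⟨h1, h2⟩ := mem_totalComplex_chains.mp hx m hm.2
    exact ⟨h1, by omega, hm.1⟩
  refine ⟨_, hy, sub_mem hx (mem_chains_of_mem_T hy), ?_⟩
  rw [mem_totalComplex_fil]
  intro m hm
  rw [Finsupp.sub_apply, Finsupp.filter_apply] at hm
  split_ifs at hm with h
  · simp at hm
  · rw [sub_zero] at hm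
    have := mem_totalComplex_fil.mp hx' m hm
    omega

/-- The `δ`-part of `D x` always lies in `F_{q+1}`, while `d x` stays in filtration degree exactly
`q` and so lies in `F_{q+1}` only if it vanishes. -/
theorem bd_mem_fil_iff_of_mem_T {p q : ℤ} {x : (V → Fin 3) →₀ ℤ} (hx : x ∈ T G p q) :
    (totalComplex G).bd x ∈ (totalComplex G).fil (q + 1) ↔ dMap x = 0 := by
  rw [totalComplex_bd, Submodule.add_mem_iff_left _ (deltaMap_mem_fil (mem_fil_of_mem_T hx))]
  refine ⟨fun h => eq_zero_of_mem_T_of_mem_fil ((rowComplex G q).bd_mem p x hx) h, fun h => ?_⟩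
  rw [h]
  exact zero_mem _

theorem mem_approxCycles_of_mem_cyc {p q : ℤ} {x : (V → Fin 3) →₀ ℤ}
    (hx : x ∈ (rowComplex G q).cyc p) : x ∈ (totalComplex G).approxCycles 1 p q :=
  ⟨⟨mem_chains_of_mem_T hx.1, mem_fil_of_mem_T hx.1⟩, (bd_mem_fil_iff_of_mem_T hx.1).mpr hx.2⟩

theorem mem_approxCycles_zero {p q : ℤ} {x : (V → Fin 3) →₀ ℤ} :
    x ∈ (totalComplex G).approxCycles (1 - 1) p q ↔
      x ∈ (totalComplex G).chains (p - q) ∧ x ∈ (totalComplex G).fil q := by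
  refine ⟨fun h => h.1, fun h => ⟨h, ?_⟩⟩
  change (totalComplex G).bd x ∈ (totalComplex G).fil (q + (1 - 1))
  rw [sub_self, add_zero]
  exact (totalComplex G).bd_fil q x h.2

/-- An element of `T_{p,q}` represents zero in `E^1_{p,q}` iff it is a boundary of its row. -/
theorem mem_approxBoundaries_iff_of_mem_T {p q : ℤ} {x : (V → Fin 3) →₀ ℤ} (hx : x ∈ T G p q) :
    x ∈ (totalComplex G).approxBoundaries 1 p q ↔ ∃ y ∈ T G (p + 1) q, dMap y = x := by
  rw [FilteredComplex.mem_approxBoundaries]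
  simp only [mem_approxCycles_zero, sub_add_cancel]
  rw [show p - 1 + 2 = p + 1 by ring, show p + 1 - (q + 1) = p - q by ring]
  constructor
  · rintro ⟨a, ⟨-, ha⟩, b, ⟨hb, hb'⟩, rfl⟩
    obtain ⟨y, hy, -, hby⟩ := exists_mem_T_sub_mem_fil hb hb'
    refine ⟨y, hy, ?_⟩
    have hdy : dMap y ∈ T G p q := by
      have := (rowComplex G q).bd_mem _ y hy
      rwa [add_sub_cancel_right] at this
    -- Only the leading part `y` of `b` matters: `x - d y` is homogeneous with `q` 2-marks and also
    -- lies in `F_{q+1}`, so it is zero.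
    refine (sub_eq_zero.mp (eq_zero_of_mem_T_of_mem_fil (sub_mem hx hdy) ?_)).symm
    have h : a + (totalComplex G).bd b - dMap y =
        a + ((totalComplex G).bd (b - y) + deltaMap y) := by
      rw [map_sub, totalComplex_bd y]
      abel
    rw [h]
    exact add_mem ha (add_mem ((totalComplex G).bd_fil _ _ hby)
      (deltaMap_mem_fil (mem_fil_of_mem_T hy)))
  · rintro ⟨y, hy, rfl⟩
    have hδ := deltaMap_mem_T hy
    have hδ' := mem_chains_of_mem_T hδ
    rw [show p + 1 - (q + 1) = p - q by ring] at hδ'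
    -- Writes `d y = -δ y + D y`, where `δ y` lies in `F_{q+1}`.
    refine ⟨-deltaMap y, ⟨neg_mem hδ', neg_mem (mem_fil_of_mem_T hδ)⟩, y,
      ⟨mem_chains_of_mem_T hy, mem_fil_of_mem_T hy⟩, ?_⟩
    rw [totalComplex_bd]
    abel

variable {E : SpectralSequence (ModuleCat.{u} ℤ) pageShape 0}

/-- Modulo `F_{q+1}`, an element of `Z^1_{p,q}` equals its leading part in `T_{p,q}`, which is a
`d`-cycle. Thus row cycles surject onto `E^1`, and the kernel is that of `cls` by
`mem_approxBoundaries_iff_of_mem_T`. -/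
theorem exists_row_equiv (R : (totalComplex G).SpectralSequenceData E) (p q : ℤ) :
    ∃ e : (E.page 1 zero_le_one).X (p, q) ≃ₗ[ℤ] (rowComplex G q).homology p,
      ∀ x : (rowComplex G q).cyc p,
        e (R.proj 1 zero_le_one p q ⟨x, mem_approxCycles_of_mem_cyc x.2⟩) =
          (rowComplex G q).cls p x := by
  let f : (rowComplex G q).cyc p →+ (E.page 1 zero_le_one).X (p, q) := AddMonoidHom.mk'
    (fun x => R.proj 1 zero_le_one p q ⟨x, mem_approxCycles_of_mem_cyc x.2⟩)
    (fun x y => map_add (R.proj 1 zero_le_one p q) ⟨x, mem_approxCycles_of_mem_cyc x.2⟩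
      ⟨y, mem_approxCycles_of_mem_cyc y.2⟩)
  let g := ((rowComplex G q).cls p).toAddMonoidHom
  have hf : Function.Surjective f := by
    intro y
    obtain ⟨z, rfl⟩ := R.proj_surjective 1 zero_le_one p q y
    obtain ⟨x, hx, hzx, hzx'⟩ := exists_mem_T_sub_mem_fil z.2.1.1 z.2.1.2
    have hdx : dMap x = 0 := by
      rw [← bd_mem_fil_iff_of_mem_T hx,
        show (totalComplex G).bd x = (totalComplex G).bd z - (totalComplex G).bd (z - x) by
          rw [map_sub, sub_sub_cancel]]
      exact sub_mem z.2.2 ((totalComplex G).bd_fil _ _ hzx')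
    refine ⟨⟨x, hx, hdx⟩, sub_eq_zero.mp ((map_sub (R.proj 1 zero_le_one p q) _ _).symm.trans
      ((R.proj_eq_zero_iff _ _ _ _ _).mpr ?_))⟩
    refine (totalComplex G).mem_approxBoundaries.mpr ⟨x - z, ?_, 0, zero_mem _, ?_⟩
    · rw [mem_approxCycles_zero, show p + 1 - (q + 1) = p - q by ring,
        ← neg_sub (z : (V → Fin 3) →₀ ℤ) x]
      exact ⟨neg_mem hzx, neg_mem hzx'⟩
    · rw [map_zero, add_zero]
      rfl
  have hfg (x) : f x = 0 ↔ g x = 0 := by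
    have h1 := R.proj_eq_zero_iff 1 zero_le_one p q ⟨x, mem_approxCycles_of_mem_cyc x.2⟩
    have h2 := (rowComplex G q).cls_eq_zero_iff x
    exact h1.trans ((mem_approxBoundaries_iff_of_mem_T x.2.1).trans h2.symm)
  obtain ⟨e, he⟩ := exists_linearEquiv_of_surjective f g hf
    ((rowComplex G q).cls_surjective p) hfg
  exact ⟨e, he⟩

theorem deltaMap_mem_cyc {p q : ℤ} {x : (V → Fin 3) →₀ ℤ} (hx : x ∈ (rowComplex G q).cyc p) :
    deltaMap x ∈ (rowComplex G (q + 1)).cyc p := by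
  refine ⟨deltaMap_mem_T hx.1, ?_⟩
  change dMap (deltaMap x) = 0
  have h := dMap_deltaMap x
  rwa [show dMap x = 0 from hx.2, map_zero, add_zero] at h

/-- The first page is the homology of the rows, with differential induced by `δ`. -/
theorem exists_first_page_equiv (R : (totalComplex G).SpectralSequenceData E) :
    ∃ ψ : ∀ p q : ℤ, (E.page 1 zero_le_one).X (p, q) ≃ₗ[ℤ] (rowComplex G q).homology p,
      (∀ (p q : ℤ) (x : (rowComplex G q).cyc p),
        ∃ h : (x : (V → Fin 3) →₀ ℤ) ∈ (totalComplex G).approxCycles 1 p q,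
          ψ p q (R.proj 1 zero_le_one p q ⟨x, h⟩) = (rowComplex G q).cls p x) ∧
      (∀ (p q : ℤ) (x : (rowComplex G q).cyc p),
        ∃ h : deltaMap (x : (V → Fin 3) →₀ ℤ) ∈ (rowComplex G (q + 1)).cyc p,
          ψ p (q + 1) (((E.page 1 zero_le_one).d (p, q) (p, q + 1)).hom
            ((ψ p q).symm ((rowComplex G q).cls p x))) =
            (rowComplex G (q + 1)).cls p ⟨deltaMap (x : (V → Fin 3) →₀ ℤ), h⟩) := by
  choose ψ hψ using exists_row_equiv R
  refine ⟨ψ, fun p q x => ⟨_, hψ p q x⟩, fun p q x => ⟨deltaMap_mem_cyc x.2, ?_⟩⟩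
  obtain ⟨h, hd⟩ := R.d_proj_of_eq zero_le_one (p := p) (q := q) (p' := p) (q' := q + 1)
    (by ring) rfl ⟨x, mem_approxCycles_of_mem_cyc x.2⟩
  have hbd : (totalComplex G).bd x = deltaMap (x : (V → Fin 3) →₀ ℤ) := by
    rw [totalComplex_bd, show dMap (x : (V → Fin 3) →₀ ℤ) = 0 from x.2.2, zero_add]
  rw [← hψ p q x, LinearEquiv.symm_apply_apply, hd, ← hψ p (q + 1) ⟨_, deltaMap_mem_cyc x.2⟩]
  simp only [hbd]

end Graph

/-! ### The homology of the total complex -/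

section Contraction

theorem sgn_mul_self {V : Type u} [LinearOrder V] (S : Finset V) (v : V) :
    sgn S v * sgn S v = 1 := by
  rw [sgn, ← mul_pow]
  simp

theorem numMarked_zero {V : Type u} [Fintype V] : numMarked (0 : V → Fin 3) = 0 := by
  simp [numMarked]

theorem numTwo_zero {V : Type u} [Fintype V] : numTwo (0 : V → Fin 3) = 0 := by
  simp [numTwo, labelled]

/-- A linear map on a free module has values in `P` if it maps the basis to `P`. -/
theorem map_mem_of_forall_single {α N : Type*} [AddCommGroup N] {S : Set α}
    (f : (α →₀ ℤ) →ₗ[ℤ] N) {P : Submodule ℤ N} (h : ∀ m ∈ S, f (Finsupp.single m 1) ∈ P)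
    {x : α →₀ ℤ} (hx : x ∈ Finsupp.supported ℤ ℤ S) : f x ∈ P := by
  rw [Finsupp.supported_eq_span_single] at hx
  have : Submodule.span ℤ ((fun i => Finsupp.single i (1 : ℤ)) '' S) ≤ P.comap f := by
    rw [Submodule.span_le]
    rintro _ ⟨m, hm, rfl⟩
    exact h m hm
  exact this hx

variable {V : Type u} [Fintype V] [LinearOrder V] {G : SimpleGraph V}

theorem bd_single (m : V → Fin 3) :
    (totalComplex G).bd (Finsupp.single m 1) = ∑ v ∈ labelled m 1, sgn (labelled m 1) v •
      (Finsupp.single (Function.update m v 0) (1 : ℤ) +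
        Finsupp.single (Function.update m v 2) 1) := by
  rw [totalComplex_bd, dMap, deltaMap, relabel_single, relabel_single, ← Finset.sum_add_distrib]
  simp only [smul_add]

/-- The homotopy that turns a 2-mark at `v` into a 1-mark. -/
def unmarkTwo (v : V) : ((V → Fin 3) →₀ ℤ) →ₗ[ℤ] ((V → Fin 3) →₀ ℤ) :=
  Finsupp.linearCombination ℤ fun m => if m v = 2 then
    sgn (labelled (Function.update m v 1) 1) v • Finsupp.single (Function.update m v 1) (1 : ℤ)
    else 0

theorem unmarkTwo_single_of_eq {v : V} {m : V → Fin 3} (h : m v = 2) :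
    unmarkTwo v (Finsupp.single m 1) = sgn (labelled (Function.update m v 1) 1) v •
      Finsupp.single (Function.update m v 1) (1 : ℤ) := by
  simp [unmarkTwo, h]

theorem unmarkTwo_single_of_ne {v : V} {m : V → Fin 3} (h : m v ≠ 2) :
    unmarkTwo v (Finsupp.single m 1) = 0 := by
  simp [unmarkTwo, h]

/-- For a marking with label 2 at `v`, the boundary of its image under `unmarkTwo v` contains it
with coefficient 1, since the sign is squared. All other terms have label 0 or 1 at `v`. -/
theorem sub_bd_unmarkTwo_mem (v : V) (x : (V → Fin 3) →₀ ℤ) :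
    x - (totalComplex G).bd (unmarkTwo v x) ∈ Finsupp.supported ℤ ℤ {m | m v ≠ 2} := by
  refine map_mem_of_forall_single (S := Set.univ)
    (LinearMap.id - (totalComplex G).bd ∘ₗ unmarkTwo v) (fun m _ => ?_) (by simp)
  change Finsupp.single m 1 - (totalComplex G).bd (unmarkTwo v (Finsupp.single m 1)) ∈ _
  by_cases hm : m v = 2
  swap
  · rw [unmarkTwo_single_of_ne hm, map_zero, sub_zero]
    exact Finsupp.single_mem_supported ℤ 1 hm
  set n := Function.update m v 1 with hn
  have hnv : v ∈ labelled n 1 := by simp [labelled, hn]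
  have hnm : Function.update n v 2 = m := by
    rw [hn, Function.update_idem, ← hm, Function.update_eq_self]
  rw [unmarkTwo_single_of_eq hm, map_smul, bd_single, ← Finset.add_sum_erase _ _ hnv, hnm,
    smul_add, smul_smul, sgn_mul_self, one_smul, ← sub_sub, sub_add_eq_sub_sub_swap, sub_self,
    zero_sub]
  refine sub_mem (neg_mem (Finsupp.single_mem_supported ℤ 1 ?_))
    (Submodule.smul_mem _ _ (sum_mem fun w hw => Submodule.smul_mem _ _
      (add_mem (Finsupp.single_mem_supported ℤ 1 ?_) (Finsupp.single_mem_supported ℤ 1 ?_))))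
  · simp
  · simp [Function.update_of_ne (Finset.ne_of_mem_erase hw).symm]
  · simp [Function.update_of_ne (Finset.ne_of_mem_erase hw).symm]

/-- If label 2 at `v` does not occur in `x`, it can arise in `D x` only by changing a 1-mark at `v`,
and `m` is the only source of `m_{v ↦ 2}`. For a cycle this forces the coefficient of `m` to vanish.
-/
theorem bd_apply_update {v : V} {x : (V → Fin 3) →₀ ℤ}
    (hx : x ∈ Finsupp.supported ℤ ℤ {m : V → Fin 3 | m v ≠ 2}) {m : V → Fin 3} (hm : m v = 1) :
    (totalComplex G).bd x (Function.update m v 2) = sgn (labelled m 1) v * x m := by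
  have h := map_mem_of_forall_single (P := ⊥)
    (Finsupp.lapply (Function.update m v 2) ∘ₗ (totalComplex G).bd -
      sgn (labelled m 1) v • Finsupp.lapply m) (fun n hn => ?_) hx
  · rw [Submodule.mem_bot] at h
    exact sub_eq_zero.mp h
  rw [Submodule.mem_bot]
  change (totalComplex G).bd (Finsupp.single n 1) (Function.update m v 2) -
    sgn (labelled m 1) v * Finsupp.single n 1 m = 0
  have hn' : n v ≠ 2 := hn
  have hzero (w : V) (a : Fin 3) (hwa : w ≠ v ∨ a = 0) :
      Finsupp.single (Function.update n w a) (1 : ℤ) (Function.update m v 2) = 0 := by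
    refine Finsupp.single_eq_of_ne fun h => ?_
    have := congrFun h v
    by_cases hw : w = v
    · subst hw
      simp [hwa.resolve_left (fun h => h rfl)] at this
    · rw [Function.update_self, Function.update_of_ne (Ne.symm hw)] at this
      exact hn' this.symm
  rw [bd_single, Finsupp.finsetSum_apply]
  by_cases hnm : n = m
  · subst hnm
    rw [Finset.sum_eq_single v]
    · rw [Finsupp.smul_apply, Finsupp.add_apply, hzero v 0 (Or.inr rfl)]
      simp
    · intro w _ hw
      rw [Finsupp.smul_apply, Finsupp.add_apply, hzero w 0 (Or.inr rfl), hzero w 2 (Or.inl hw)]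
      simp
    · intro h
      simp [labelled, hm] at h
  · rw [Finsupp.single_eq_of_ne (Ne.symm hnm), mul_zero, sub_zero]
    refine Finset.sum_eq_zero fun w hw => ?_
    have hw1 : n w = 1 := by simpa [labelled] using hw
    rw [Finsupp.smul_apply, Finsupp.add_apply, hzero w 0 (Or.inr rfl), zero_add]
    by_cases hwv : w = v
    · subst hwv
      rw [Finsupp.single_eq_of_ne, smul_zero]
      intro h
      refine hnm ?_
      -- Resetting the label at `w` to 1 recovers both original labellings.
      have := congrArg (fun f => Function.update f w 1) h
      simp only [Function.update_idem] at this
      rw [← hw1] at this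
      nth_rw 1 [hw1, ← hm] at this
      simpa using this.symm
    · rw [hzero w 2 (Or.inl hwv), smul_zero]

theorem unmarkTwo_mem_chains {v : V} {n : ℤ} {x : (V → Fin 3) →₀ ℤ}
    (hx : x ∈ (totalComplex G).chains n) : unmarkTwo v x ∈ (totalComplex G).chains (n + 1) := by
  refine map_mem_of_forall_single _ ?_ hx
  rintro m ⟨h1, h2⟩
  by_cases hm : m v = 2
  swap
  · rw [unmarkTwo_single_of_ne hm]
    exact zero_mem _
  rw [unmarkTwo_single_of_eq hm]
  refine Submodule.smul_mem _ _ (Finsupp.single_mem_supported ℤ 1 ?_)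
  have h : Function.update (Function.update m v 1) v 2 = m := by
    rw [Function.update_idem, ← hm, Function.update_eq_self]
  have hv : Function.update m v 1 v = 1 := by simp
  have ha := numMarked_update_two hv
  have hb := numTwo_update_two hv
  rw [h] at ha hb
  refine ⟨?_, by omega⟩
  refine Set.Pairwise.mono (fun w (hw : _ ≠ _) => ?_) h1
  change m w ≠ 0
  by_cases hwv : w = v
  · rw [hwv, hm]
    decide
  · rwa [Function.update_of_ne hwv] at hw

theorem unmarkTwo_mem_supported {v : V} {S : Finset V} (hv : v ∈ S) {x : (V → Fin 3) →₀ ℤ}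
    (hx : x ∈ Finsupp.supported ℤ ℤ {m : V → Fin 3 | ∀ w ∉ S, m w = 0}) :
    unmarkTwo v x ∈ Finsupp.supported ℤ ℤ {m : V → Fin 3 | ∀ w ∉ S, m w = 0} := by
  refine map_mem_of_forall_single _ (fun m hm => ?_) hx
  by_cases hmv : m v = 2
  swap
  · rw [unmarkTwo_single_of_ne hmv]
    exact zero_mem _
  rw [unmarkTwo_single_of_eq hmv]
  refine Submodule.smul_mem _ _ (Finsupp.single_mem_supported ℤ 1 fun w hw => ?_)
  have hwv : w ≠ v := fun h => hw (h ▸ hv)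
  rw [Function.update_of_ne hwv]
  exact hm w hw

theorem bd_mem_supported {S : Finset V} {x : (V → Fin 3) →₀ ℤ}
    (hx : x ∈ Finsupp.supported ℤ ℤ {m : V → Fin 3 | ∀ w ∉ S, m w = 0}) :
    (totalComplex G).bd x ∈ Finsupp.supported ℤ ℤ {m : V → Fin 3 | ∀ w ∉ S, m w = 0} := by
  have (a : Fin 3) : relabel a x ∈ Finsupp.supported ℤ ℤ {m : V → Fin 3 | ∀ w ∉ S, m w = 0} := by
    refine relabel_mem (fun m hm v hv w hw => ?_) x hx
    have hwv : w ≠ v := by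
      rintro rfl
      simp [hm w hw] at hv
    rw [Function.update_of_ne hwv]
    exact hm w hw
  exact add_mem (this 0) (this 2)

/-- Every cycle is homologous to a multiple of the empty marking. -/
theorem exists_sub_bd_eq_single {n : ℤ} {x : (V → Fin 3) →₀ ℤ}
    (hx : x ∈ (totalComplex G).cyc n) : ∃ y ∈ (totalComplex G).chains (n + 1), ∃ c : ℤ,
      x = (totalComplex G).bd y + Finsupp.single 0 c := by
  -- Induction on a set `S` of vertices that may still carry marks.
  suffices h : ∀ (S : Finset V) (x : (V → Fin 3) →₀ ℤ), x ∈ (totalComplex G).cyc n →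
      x ∈ Finsupp.supported ℤ ℤ {m : V → Fin 3 | ∀ w ∉ S, m w = 0} →
      ∃ y ∈ (totalComplex G).chains (n + 1), ∃ c : ℤ,
        x = (totalComplex G).bd y + Finsupp.single 0 c from
    h Finset.univ x hx (by simp)
  intro S
  induction S using Finset.induction_on with
  | empty =>
    intro x _ hx
    refine ⟨0, zero_mem _, x 0, ?_⟩
    rw [map_zero, zero_add]
    ext m
    by_cases hm : m = 0
    · simp [hm]
    · rw [Finsupp.single_eq_of_ne hm]
      by_contra h
      exact hm (funext fun w => hx (Finsupp.mem_support_iff.mpr h) w (Finset.notMem_empty w))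
  | insert v S _ ih =>
    intro x hx hxS
    have hy := unmarkTwo_mem_chains (v := v) hx.1
    have hyS := unmarkTwo_mem_supported (Finset.mem_insert_self v S) hxS
    have hx1 := sub_bd_unmarkTwo_mem (G := G) v x
    have hx1S := sub_mem hxS (bd_mem_supported (G := G) hyS)
    have hby := (totalComplex G).bd_mem _ _ hy
    rw [add_sub_cancel_right] at hby
    have hd : (totalComplex G).bd (x - (totalComplex G).bd (unmarkTwo v x)) = 0 := by
      rw [map_sub, (totalComplex G).bd_bd, sub_zero]
      exact hx.2
    obtain ⟨z, hz, c, hc⟩ := ih (x - (totalComplex G).bd (unmarkTwo v x))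
      ⟨sub_mem hx.1 hby, hd⟩ (fun m hm w hw => by
        by_cases hwv : w = v
        · subst hwv
          have h2 : m w ≠ 2 := hx1 hm
          -- Label 2 at this vertex has been removed; the cycle condition now excludes label 1, so
          -- the support shrinks to `S`.
          have h1 : m w ≠ 1 := by
            intro h1
            have h := bd_apply_update (G := G) hx1 h1
            rw [hd, Finsupp.zero_apply, eq_comm, mul_eq_zero] at h
            refine Finsupp.mem_support_iff.mp hm (h.resolve_left ?_)
            exact left_ne_zero_of_mul_eq_one (sgn_mul_self _ _)
          generalize m w = a at h1 h2
          revert a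
          decide
        · exact hx1S hm w (by simp [hwv, hw]))
    refine ⟨unmarkTwo v x + z, add_mem hy hz, c, ?_⟩
    rw [map_add, add_assoc, ← hc]
    abel

theorem single_zero_mem_cyc (c : ℤ) : Finsupp.single 0 c ∈ (totalComplex G).cyc 0 := by
  constructor
  · refine Finsupp.single_mem_supported ℤ c ⟨?_, by rw [numMarked_zero, numTwo_zero]; rfl⟩
    simp [IsMarking, SimpleGraph.IsIndepSet]
  · have h : Finsupp.single (0 : V → Fin 3) c = c • Finsupp.single 0 1 := by simp
    rw [h]
    refine Submodule.smul_mem _ _ ?_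
    rw [LinearMap.mem_ker, bd_single]
    simp [labelled]

/-- The empty marking has degree 0, so in any other degree the leftover multiple of it must be zero.
-/
theorem subsingleton_homology {n : ℤ} (hn : n ≠ 0) :
    Subsingleton ((totalComplex G).homology n) := by
  refine subsingleton_of_forall_eq 0 fun h => ?_
  obtain ⟨x, rfl⟩ := (totalComplex G).cls_surjective n h
  obtain ⟨y, hy, c, hx⟩ := exists_sub_bd_eq_single x.2
  refine ((totalComplex G).cls_eq_zero_iff x).mpr ⟨y, hy, ?_⟩
  have hby := (totalComplex G).bd_mem _ _ hy
  rw [add_sub_cancel_right] at hby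
  have hc : Finsupp.single 0 c ∈ (totalComplex G).chains n := by
    rw [← sub_eq_of_eq_add' hx]
    exact sub_mem x.2.1 hby
  by_cases hc0 : c = 0
  · rw [hx, hc0, Finsupp.single_zero, add_zero]
  · have := (mem_totalComplex_chains.mp hc 0 (by simpa using hc0)).2
    rw [numMarked_zero, numTwo_zero] at this
    omega

/-- The augmentation of the total complex. -/
def augmentation : ((V → Fin 3) →₀ ℤ) →ₗ[ℤ] ℤ :=
  Finsupp.linearCombination ℤ fun m =>
    if labelled m 1 = ∅ then (-1) ^ (labelled m 2).card else 0

theorem augmentation_single (m : V → Fin 3) (c : ℤ) :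
    augmentation (Finsupp.single m c) =
      c * if labelled m 1 = ∅ then (-1) ^ (labelled m 2).card else 0 := by
  simp [augmentation]

theorem augmentation_single_zero (c : ℤ) :
    augmentation (Finsupp.single (0 : V → Fin 3) c) = c := by
  rw [augmentation_single]
  simp [labelled]

/-- The labellings `m_{v ↦ 0}` and `m_{v ↦ 2}` have the same 1-marks and their numbers of 2-marks
differ by one, so their contributions cancel. -/
theorem augmentation_bd (x : (V → Fin 3) →₀ ℤ) : augmentation ((totalComplex G).bd x) = 0 := by
  refine (Submodule.mem_bot ℤ).mp (map_mem_of_forall_single (S := Set.univ)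
    (augmentation ∘ₗ (totalComplex G).bd) (fun m _ => ?_) (by simp))
  rw [Submodule.mem_bot, LinearMap.comp_apply, bd_single, map_sum]
  refine Finset.sum_eq_zero fun v hv => ?_
  have hv1 : m v = 1 := by simpa [labelled] using hv
  have h0 : (labelled (Function.update m v 0) 2).card = (labelled m 2).card :=
    Nat.cast_injective (R := ℤ) (numTwo_update_zero hv1)
  have h2 : (labelled (Function.update m v 2) 2).card = (labelled m 2).card + 1 := by
    have := numTwo_update_two hv1
    unfold numTwo at this
    omega
  rw [map_smul, map_add, augmentation_single, augmentation_single,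
    labelled_update _ _ (by decide), labelled_update _ _ (by decide), h0, h2, pow_succ]
  split_ifs <;> simp

/-- The class of a cycle of degree zero is determined by its augmentation. -/
theorem cls_eq_cls_iff_augmentation (x y : (totalComplex G).cyc 0) :
    (totalComplex G).cls 0 x = (totalComplex G).cls 0 y ↔
      augmentation (x : (V → Fin 3) →₀ ℤ) = augmentation (y : (V → Fin 3) →₀ ℤ) := by
  rw [SubComplex.cls_eq_cls_iff]
  constructor
  · rintro ⟨z, -, hz⟩
    rw [← sub_eq_zero, ← map_sub, ← hz, augmentation_bd]
  · intro h
    obtain ⟨z, hz, c, hc⟩ := exists_sub_bd_eq_single (sub_mem x.2 y.2)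
    refine ⟨z, hz, ?_⟩
    have := congrArg augmentation hc
    rw [map_sub, h, sub_self, map_add, augmentation_bd, zero_add,
      augmentation_single_zero] at this
    rw [hc, ← this, Finsupp.single_zero, add_zero]

theorem exists_homology_zero_equiv :
    ∃ e : (totalComplex G).homology 0 ≃ₗ[ℤ] ℤ, ∀ x : (totalComplex G).cyc 0,
      e ((totalComplex G).cls 0 x) = augmentation (x : (V → Fin 3) →₀ ℤ) := by
  let f := ((totalComplex G).cls 0).toAddMonoidHom
  let g : (totalComplex G).cyc 0 →+ ℤ :=
    augmentation.toAddMonoidHom.comp ((totalComplex G).cyc 0).subtype.toAddMonoidHom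
  have hg : Function.Surjective g := fun c => ⟨⟨_, single_zero_mem_cyc c⟩,
    augmentation_single_zero c⟩
  have hfg (x) : f x = 0 ↔ g x = 0 := by
    have h := cls_eq_cls_iff_augmentation x 0
    rw [map_zero, ZeroMemClass.coe_zero, map_zero] at h
    exact h
  obtain ⟨e, he⟩ := exists_linearEquiv_of_surjective f g ((totalComplex G).cls_surjective 0) hg hfg
  exact ⟨e, he⟩

end Contraction

/-! ### Splitting the rows into augmented chain complexes -/

open DirectSum

/-- A complex that splits as a finite sum of complexes has the sum of their homology groups as
its homology. -/
theorem exists_homology_equiv_directSum {M : Type u} [AddCommGroup M] (C : SubComplex M)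
    {ι : Type*} [Fintype ι] {N : ι → Type u} [∀ i, AddCommGroup (N i)]
    (D : ∀ i, SubComplex (N i)) (φ : ∀ i, N i →ₗ[ℤ] M) (π : ∀ i, M →ₗ[ℤ] N i) (c : ℤ)
    (hφ : ∀ i k, ∀ x ∈ (D i).chains k, φ i x ∈ C.chains (k + c))
    (hπ : ∀ i k, ∀ x ∈ C.chains (k + c), π i x ∈ (D i).chains k)
    (hbd : ∀ i x, C.bd (φ i x) = φ i ((D i).bd x))
    (hπφ : ∀ i x, π i (φ i x) = x) (hne : ∀ i j x, i ≠ j → π i (φ j x) = 0)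
    (hsum : ∀ k, ∀ x ∈ C.chains (k + c), ∑ i, φ i (π i x) = x) (k : ℤ) :
    Nonempty (C.homology (k + c) ≃+ ∀ i, (D i).homology k) := by
  classical
  have hπsum (i) (y : ∀ i, N i) : π i (∑ j, φ j (y j)) = y i := by
    rw [map_sum, Finset.sum_eq_single i (fun j _ hj => hne i j _ (Ne.symm hj)) (by simp), hπφ]
  -- Compatibility of the projections with the differential is not assumed; it follows on chains by
  -- decomposing `x` and using that the inclusions are chain maps.
  have hπbd (i k) (x : M) (hx : x ∈ C.chains (k + c)) : π i (C.bd x) = (D i).bd (π i x) := by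
    conv_lhs => rw [← hsum k x hx, map_sum]
    simp only [hbd]
    exact hπsum i fun i => (D i).bd (π i x)
  have hcyc (i k) {x : M} (hx : x ∈ C.cyc (k + c)) : π i x ∈ (D i).cyc k := by
    refine ⟨hπ i k x hx.1, ?_⟩
    change (D i).bd (π i x) = 0
    rw [← hπbd i k x hx.1, LinearMap.mem_ker.mp hx.2, map_zero]
  let f := (C.cls (k + c)).toAddMonoidHom
  let g : C.cyc (k + c) →+ ∀ i, (D i).homology k := AddMonoidHom.mk'
    (fun x i => (D i).cls k ⟨π i x, hcyc i k x.2⟩) fun x y => by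
      ext i
      refine Eq.trans (congrArg _ (Subtype.ext ?_)) (map_add ((D i).cls k)
        ⟨π i x, hcyc i k x.2⟩ ⟨π i y, hcyc i k y.2⟩)
      exact map_add (π i) (x : M) y
  have hg : Function.Surjective g := by
    intro h
    choose z hz using fun i => (D i).cls_surjective k (h i)
    refine ⟨⟨∑ i, φ i (z i), sum_mem fun i _ => hφ i k _ (z i).2.1, ?_⟩, funext fun i => ?_⟩
    · change C.bd (∑ i, φ i (z i)) = 0
      rw [map_sum]
      refine Finset.sum_eq_zero fun i _ => ?_
      rw [hbd, LinearMap.mem_ker.mp (z i).2.2, map_zero]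
    · rw [← hz i]
      exact congrArg ((D i).cls k) (Subtype.ext (hπsum i fun i => (z i : N i)))
  have hfg (x) : f x = 0 ↔ g x = 0 := by
    refine (C.cls_eq_zero_iff x).trans (Iff.trans ?_ funext_iff.symm)
    have hcls (i) : g x i = 0 ↔ ∃ y ∈ (D i).chains (k + 1), (D i).bd y = π i x :=
      (D i).cls_eq_zero_iff _
    simp only [Pi.zero_apply, hcls]
    rw [add_right_comm]
    constructor
    · rintro ⟨y, hy, hyx⟩ i
      exact ⟨π i y, hπ i _ y hy, by rw [← hyx, hπbd i _ y hy]⟩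
    · intro h
      choose y hy hyx using h
      refine ⟨∑ i, φ i (y i), sum_mem fun i _ => hφ i _ _ (hy i), ?_⟩
      rw [map_sum, ← hsum k x x.2.1]
      simp only [hbd, hyx]
  obtain ⟨e, -⟩ := exists_linearEquiv_of_surjective f g (C.cls_surjective _) hg hfg
  exact ⟨e.toAddEquiv⟩

section Marking

theorem isIndepSet_labelled_two {V : Type u} [Fintype V] {G : SimpleGraph V}
    {m : V → Fin 3} (hm : IsMarking G m) :
    G.IsIndepSet (labelled m 2 : Set V) := by
  refine Set.Pairwise.mono (fun v hv => ?_) hm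
  have : m v = 2 := by simpa [labelled] using hv
  change m v ≠ 0
  rw [this]
  decide

variable {V W : Type u} [LinearOrder V] [LinearOrder W]

/-- The labelling with value 2 on `U` and value 1 on the image of `s`. -/
def toMarking (U : Finset V) (e : W ↪o V) (s : Finset W) : V → Fin 3 := fun v =>
  if v ∈ U then 2 else if v ∈ s.map e.toEmbedding then 1 else 0

variable {U : Finset V} {e : W ↪o V}

theorem toMarking_ne_zero_iff (s : Finset W) (v : V) :
    toMarking U e s v ≠ 0 ↔ v ∈ U ∨ v ∈ s.map e.toEmbedding := by
  unfold toMarking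
  split_ifs <;> simp_all

theorem toMarking_eq_two_iff (s : Finset W) (v : V) : toMarking U e s v = 2 ↔ v ∈ U := by
  unfold toMarking
  split_ifs <;> simp_all

theorem toMarking_eq_one_iff (he : ∀ w, e w ∉ U) (s : Finset W) (v : V) :
    toMarking U e s v = 1 ↔ v ∈ s.map e.toEmbedding := by
  have : v ∈ s.map e.toEmbedding → v ∉ U := by
    rw [Finset.mem_map]
    rintro ⟨w, -, rfl⟩
    exact he w
  unfold toMarking
  split_ifs <;> simp_all

theorem toMarking_injective (he : ∀ w, e w ∉ U) : Function.Injective (toMarking U e) := by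
  intro s t h
  refine Finset.map_injective e.toEmbedding (Finset.ext fun v => ?_)
  rw [← toMarking_eq_one_iff he, h, toMarking_eq_one_iff he]

theorem update_toMarking_zero (he : ∀ w, e w ∉ U) (s : Finset W) (w : W) :
    Function.update (toMarking U e s) (e w) 0 = toMarking U e (s.erase w) := by
  ext v
  by_cases h : v = e w
  · subst h
    simp [toMarking, he w]
  · rw [Function.update_of_ne h]
    simp only [toMarking, Finset.map_erase, Finset.mem_erase]
    simp [h]

/-- This is where `e` must preserve the order: the signs count smaller vertices on both sides. -/
theorem sgn_map (s : Finset W) (w : W) : sgn (s.map e.toEmbedding) (e w) = sgn s w := by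
  have : (s.map e.toEmbedding).filter (fun v => v < e w) =
      (s.filter (fun v => v < w)).map e.toEmbedding := by
    ext v
    simp only [Finset.mem_filter, Finset.mem_map]
    constructor
    · rintro ⟨⟨w', hw', rfl⟩, h⟩
      exact ⟨w', ⟨hw', e.lt_iff_lt.mp h⟩, rfl⟩
    · rintro ⟨w', ⟨hw', h⟩, rfl⟩
      exact ⟨⟨w', hw', rfl⟩, e.lt_iff_lt.mpr h⟩
  rw [sgn, this, Finset.card_map, sgn]

variable {G : SimpleGraph V} {H : SimpleGraph W}

/-- Vertices outside `N[U]` are not adjacent to `U`, so independence of the union with `U` is a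
condition on `s` alone. -/
theorem isMarking_toMarking_iff (hU : G.IsIndepSet (U : Set V))
    (hr : Set.range e = (closedNbhd G (U : Set V))ᶜ) (hH : ∀ a b, H.Adj a b ↔ G.Adj (e a) (e b))
    (s : Finset W) : IsMarking G (toMarking U e s) ↔ H.IsIndepSet (s : Set W) := by
  have hnot (w : W) : e w ∉ closedNbhd G (U : Set V) := hr.subset (Set.mem_range_self w)
  constructor
  · intro h a ha b hb hab
    rw [hH]
    refine h ?_ ?_ (e.injective.ne hab)
    · exact (toMarking_ne_zero_iff s _).mpr (Or.inr (Finset.mem_map_of_mem _ ha))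
    · exact (toMarking_ne_zero_iff s _).mpr (Or.inr (Finset.mem_map_of_mem _ hb))
  · intro h a ha b hb hab
    rcases (toMarking_ne_zero_iff s a).mp ha with ha | ha <;>
      rcases (toMarking_ne_zero_iff s b).mp hb with hb | hb
    · exact hU ha hb hab
    · obtain ⟨w, -, rfl⟩ := Finset.mem_map.mp hb
      exact fun h => hnot w ⟨a, ha, Or.inr h⟩
    · obtain ⟨w, -, rfl⟩ := Finset.mem_map.mp ha
      exact fun h => hnot w ⟨b, hb, Or.inr h.symm⟩
    · obtain ⟨a, ha', rfl⟩ := Finset.mem_map.mp ha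
      obtain ⟨b, hb', rfl⟩ := Finset.mem_map.mp hb
      intro hadj
      exact h ha' hb' (fun h => hab (by rw [h])) ((hH a b).mpr hadj)

variable [Fintype V]

theorem labelled_toMarking_one (he : ∀ w, e w ∉ U) (s : Finset W) :
    labelled (toMarking U e s) 1 = s.map e.toEmbedding := by
  ext v
  simp only [labelled, Finset.mem_filter, Finset.mem_univ, true_and, toMarking_eq_one_iff he]

theorem labelled_toMarking_two (s : Finset W) : labelled (toMarking U e s) 2 = U := by
  ext v
  simp only [labelled, Finset.mem_filter, Finset.mem_univ, true_and, toMarking_eq_two_iff]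

theorem numMarked_toMarking (he : ∀ w, e w ∉ U) (s : Finset W) :
    numMarked (toMarking U e s) = U.card + s.card := by
  have : (Finset.univ.filter fun v => toMarking U e s v ≠ 0) = U ∪ s.map e.toEmbedding := by
    ext v
    simp only [Finset.mem_filter, Finset.mem_univ, true_and, toMarking_ne_zero_iff,
      Finset.mem_union]
  rw [numMarked, this, Finset.card_union_of_disjoint, Finset.card_map, Nat.cast_add]
  rw [Finset.disjoint_right]
  intro v hv
  obtain ⟨w, -, rfl⟩ := Finset.mem_map.mp hv
  exact he w

/-- `d` leaves the 2-marks alone and its signs count only 1-marked vertices, so it acts on the set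
of 1-marks as the simplicial boundary. -/
theorem dMap_mapDomain (he : ∀ w, e w ∉ U) (x : Finset W →₀ ℤ) :
    dMap (Finsupp.mapDomain (toMarking U e) x) =
      Finsupp.mapDomain (toMarking U e) (simplexBd x) := by
  suffices h : dMap ∘ₗ Finsupp.lmapDomain ℤ ℤ (toMarking U e) =
      Finsupp.lmapDomain ℤ ℤ (toMarking U e) ∘ₗ simplexBd from LinearMap.congr_fun h x
  ext1 s
  ext1
  simp only [LinearMap.comp_apply, Finsupp.lsingle_apply, Finsupp.lmapDomain_apply,
    Finsupp.mapDomain_single]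
  rw [dMap, relabel_single, labelled_toMarking_one he, simplexBd_single, Finset.sum_map,
    ← Finsupp.lmapDomain_apply ℤ ℤ, map_sum]
  refine Finset.sum_congr rfl fun w _ => ?_
  rw [map_smul, Finsupp.lmapDomain_apply, Finsupp.mapDomain_single]
  refine congrArg₂ _ (sgn_map s w) ?_
  exact congrArg (fun m => Finsupp.single m (1 : ℤ)) (update_toMarking_zero he s w)

/-- Every marking comes from its 2-marked set and an independent set in the complement of the
closed neighborhood of the latter. -/
theorem exists_toMarking_eq {m : V → Fin 3} (hm : IsMarking G m) (hU : labelled m 2 = U)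
    (hr : Set.range e = (closedNbhd G (U : Set V))ᶜ) : ∃ s : Finset W, toMarking U e s = m := by
  have hmem (v : V) : v ∈ U ↔ m v = 2 := by simp [← hU, labelled]
  refine ⟨(labelled m 1).preimage e e.injective.injOn, funext fun v => ?_⟩
  have h1 (h : m v = 1) : v ∈ Set.range e := by
    rw [hr]
    rintro ⟨w, hw, rfl | hadj⟩
    · rw [Finset.mem_coe, hmem, h] at hw
      exact absurd hw (by decide)
    · rw [Finset.mem_coe, hmem] at hw
      refine hm (x := w) (y := v) ?_ ?_ hadj.ne hadj
      · change m w ≠ 0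
        rw [hw]
        decide
      · change m v ≠ 0
        rw [h]
        decide
  have h2 : v ∈ ((labelled m 1).preimage e e.injective.injOn).map e.toEmbedding ↔ m v = 1 := by
    constructor
    · intro h
      obtain ⟨w, hw, rfl⟩ := Finset.mem_map.mp h
      simpa [labelled] using hw
    · intro h
      obtain ⟨w, rfl⟩ := h1 h
      exact Finset.mem_map_of_mem e.toEmbedding (by simpa [labelled] using h)
  unfold toMarking
  simp only [hmem, h2]
  generalize m v = a
  revert a
  decide

/-- The homology of the row `q` is the sum of the reduced homology groups of the independence
complexes `Ind(G - N[U])`, where `U` runs over a set of indices for the independent sets with `q`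
elements. -/
theorem exists_row_homology_equiv {ι : Type*} [Fintype ι] (U : ι → Finset V) {W : ι → Type u}
    [∀ i, LinearOrder (W i)] (e : ∀ i, W i ↪o V) (H : ∀ i, SimpleGraph (W i)) {q : ℤ}
    (hUi : Function.Injective U) (hU : ∀ i, G.IsIndepSet (U i : Set V) ∧ ((U i).card : ℤ) = q)
    (hUs : ∀ I : Finset V, G.IsIndepSet (I : Set V) → (I.card : ℤ) = q → ∃ i, U i = I)
    (hr : ∀ i, Set.range (e i) = (closedNbhd G (U i : Set V))ᶜ)
    (hH : ∀ i a b, (H i).Adj a b ↔ G.Adj (e i a) (e i b)) {k p : ℤ} (hp : p = k + (q + 1)) :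
    Nonempty ((rowComplex G q).homology p ≃+ ∀ i,
      reducedHomology (indComplex (H i)).toPreAbstractSimplicialComplex k) := by
  subst hp
  have he (i) (w : W i) : e i w ∉ U i := fun h =>
    (hr i).subset (Set.mem_range_self w) ⟨_, h, Or.inl rfl⟩
  have hinj (i) := toMarking_injective (he i)
  -- A face with `k + 1` vertices becomes a marking with `k + 1 + q` marked vertices, whence the
  -- shift by `q + 1`. The empty face corresponds to the marking with no 1-marks.
  have hmem (i k) (s : Finset (W i)) :
      ((s = ∅ ∨ s ∈ (indComplex (H i)).toPreAbstractSimplicialComplex) ∧ (s.card : ℤ) = k + 1) ↔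
        IsMarking G (toMarking (U i) (e i) s) ∧
          numMarked (toMarking (U i) (e i) s) = k + (q + 1) ∧
          numTwo (toMarking (U i) (e i) s) = q := by
    rw [isMarking_toMarking_iff (hU i).1 (hr i) (hH i), numMarked_toMarking (he i), numTwo,
      labelled_toMarking_two, (hU i).2]
    have : (s = ∅ ∨ s ∈ (indComplex (H i)).toPreAbstractSimplicialComplex) ↔
        (H i).IsIndepSet (s : Set (W i)) := by
      rcases s.eq_empty_or_nonempty with rfl | hs
      · simp [SimpleGraph.IsIndepSet]
      · simp only [hs.ne_empty, false_or]
        exact ⟨fun h => h.2, fun h => ⟨hs, h⟩⟩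
    rw [this]
    refine and_congr_right fun _ => ⟨fun h => ⟨by omega, rfl⟩, fun h => by omega⟩
  refine exists_homology_equiv_directSum (rowComplex G q)
    (fun i => augmentedChains (indComplex (H i)).toPreAbstractSimplicialComplex)
    (fun i => Finsupp.lmapDomain ℤ ℤ (toMarking (U i) (e i)))
    (fun i => Finsupp.lcomapDomain (toMarking (U i) (e i)) (hinj i)) (q + 1)
    ?_ ?_ ?_ ?_ ?_ ?_ k
  · intro i k x hx
    refine map_mem_of_forall_single _ (fun s hs => ?_) hx
    rw [Finsupp.lmapDomain_apply, Finsupp.mapDomain_single]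
    exact Finsupp.single_mem_supported ℤ 1 ((hmem i k s).mp hs)
  · intro i k x hx s hs
    refine (hmem i k s).mpr (hx ?_)
    simpa using hs
  · intro i x
    exact dMap_mapDomain (he i) x
  · intro i x
    exact Finsupp.comapDomain_mapDomain _ (hinj i) x
  · intro i j x hij
    ext s
    change Finsupp.mapDomain (toMarking (U j) (e j)) x (toMarking (U i) (e i) s) = 0
    refine Finsupp.mapDomain_of_notMem_range x _ ?_
    rintro ⟨t, ht⟩
    refine hij (hUi ?_)
    rw [← labelled_toMarking_two (U := U i) (e := e i) s, ← ht, labelled_toMarking_two]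
  · intro k x hx
    have := map_mem_of_forall_single (P := ⊥)
      (∑ i, Finsupp.lmapDomain ℤ ℤ (toMarking (U i) (e i)) ∘ₗ Finsupp.lcomapDomain
        (toMarking (U i) (e i)) (hinj i) - LinearMap.id) (fun m hm => ?_) hx
    · rw [Submodule.mem_bot, LinearMap.sub_apply, sub_eq_zero, LinearMap.sum_apply] at this
      exact this
    · obtain ⟨h1, h2, h3⟩ := hm
      -- Only the summand indexed by the 2-marked set of `m` sees `m`.
      obtain ⟨i, hi⟩ := hUs (labelled m 2) (isIndepSet_labelled_two h1) h3
      obtain ⟨s, hs⟩ := exists_toMarking_eq h1 hi.symm (hr i)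
      rw [Submodule.mem_bot, LinearMap.sub_apply, sub_eq_zero, LinearMap.sum_apply,
        Finset.sum_eq_single i]
      · change Finsupp.mapDomain _ (Finsupp.comapDomain _ _ _) = Finsupp.single m 1
        rw [← hs, ← Finsupp.mapDomain_single, Finsupp.comapDomain_mapDomain _ (hinj i)]
      · intro j _ hj
        change Finsupp.mapDomain _ (Finsupp.comapDomain _ _ _) = 0
        have : Finsupp.comapDomain (toMarking (U j) (e j)) (Finsupp.single m (1 : ℤ))
            (hinj j).injOn = 0 := by
          ext t
          rw [Finsupp.comapDomain_apply, Finsupp.zero_apply]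
          refine Finsupp.single_eq_of_ne fun h => hj (hUi ?_)
          rw [hi, ← h, labelled_toMarking_two]
        rw [this, Finsupp.mapDomain_zero]
      · simp

end Marking

/-! ### The limit page and the independence number -/

section Limit

theorem subsingleton_subquotient {R : Type} [Ring R] {N : Type u} [AddCommGroup N] [Module R N]
    {A B : Submodule R N} (h : A ≤ B) : Subsingleton (subquotient A B) := by
  refine subsingleton_of_forall_eq 0 fun y => ?_
  obtain ⟨x, hx, rfl⟩ := subquotientMk_surjective A B y
  exact (subquotientMk_eq_zero_iff hx).mpr (h hx)

theorem exists_subquotient_top_bot_equiv {N : ModuleCat.{u} ℤ} (e : N ≃ₗ[ℤ] ℤ)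
    {A B : Submodule ℤ N} (hA : A = ⊤) (hB : B = ⊥) : Nonempty (subquotient A B ≃+ ℤ) := by
  subst hA hB
  obtain ⟨e', -⟩ := exists_linearEquiv_of_surjective
    (subquotientProj (⊤ : Submodule ℤ N) ⊥).toAddMonoidHom
    (e.toLinearMap ∘ₗ (⊤ : Submodule ℤ N).subtype).toAddMonoidHom
    (subquotientProj_surjective _ _) (fun c => ⟨⟨e.symm c, trivial⟩, e.apply_symm_apply c⟩)
    fun x => (subquotientProj_eq_zero_iff x).trans
      (Submodule.mem_bot ℤ |>.trans (e.map_eq_zero_iff (x := (x : N))).symm)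
  exact ⟨e'.toAddEquiv⟩

variable {V : Type u} [Fintype V] [LinearOrder V] {G : SimpleGraph V}

theorem totalComplex_fil_eq_top {q : ℤ} (hq : q ≤ 0) : (totalComplex G).fil q = ⊤ := by
  refine eq_top_iff.mpr fun x _ => mem_totalComplex_fil.mpr fun m _ => ?_
  exact hq.trans (Int.natCast_nonneg _)

theorem totalComplex_fil_eq_bot {q : ℤ} (hq : (Fintype.card V : ℤ) < q) :
    (totalComplex G).fil q = ⊥ := by
  refine eq_bot_iff.mpr fun x hx => (Submodule.mem_bot ℤ).mpr (Finsupp.ext fun m => ?_)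
  by_contra h
  have h1 := mem_totalComplex_fil.mp hx m h
  have h2 : (labelled m 2).card ≤ Fintype.card V := Finset.card_le_univ _
  unfold numTwo at h1
  omega

/-- An independent set with `q` elements shows that all of `H_0` lies in its `q`-th filtration
step. -/
theorem homologyFil_zero_eq_top {I : Finset V} (hI : G.IsIndepSet (I : Set V)) {q : ℤ}
    (hq : q ≤ I.card) : (totalComplex G).homologyFil q 0 = ⊤ := by
  refine eq_top_iff.mpr fun y _ => ?_
  obtain ⟨x, rfl⟩ := (totalComplex G).cls_surjective 0 y
  set m : V → Fin 3 := fun v => if v ∈ I then 2 else 0 with hm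
  have h1 : labelled m 1 = ∅ := by
    ext v
    by_cases hv : v ∈ I <;> simp [labelled, hm, hv]
  have h2 : labelled m 2 = I := by
    ext v
    by_cases hv : v ∈ I <;> simp [labelled, hm, hv]
  have hne (v : V) : m v ≠ 0 ↔ v ∈ I := by
    by_cases hv : v ∈ I <;> simp [hm, hv]
  have hmark : IsMarking G m := by
    refine Set.Pairwise.mono (fun v hv => ?_) hI
    exact (hne v).mp hv
  have hnum : numMarked m - numTwo m = 0 := by
    simp only [numMarked, numTwo, h2, hne]
    simp
  have hcyc (c : ℤ) : Finsupp.single m c ∈ (totalComplex G).cyc 0 := by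
    refine ⟨Finsupp.single_mem_supported ℤ c ⟨hmark, hnum⟩, ?_⟩
    have h : Finsupp.single m c = c • Finsupp.single m (1 : ℤ) := by simp
    rw [h]
    refine Submodule.smul_mem _ _ ?_
    rw [LinearMap.mem_ker, bd_single, h1, Finset.sum_empty]
  -- The marking with label 2 on `I` has augmentation `(-1)^|I|`; this multiple of it has the
  -- augmentation of `x`, hence the same class.
  refine FilteredComplex.mem_homologyFil.mpr
    ⟨⟨_, hcyc (augmentation (x : (V → Fin 3) →₀ ℤ) * (-1) ^ I.card)⟩, ?_, ?_⟩
  · refine Finsupp.single_mem_supported ℤ _ ?_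
    change q ≤ numTwo m
    rwa [numTwo, h2]
  · rw [cls_eq_cls_iff_augmentation, augmentation_single, if_pos h1, h2, mul_assoc, ← mul_pow]
    simp

/-- The 2-marked set of a marking is independent, so beyond the largest independent sets the
filtration step contains no nonzero chains. -/
theorem homologyFil_eq_bot {q n : ℤ}
    (hq : ∀ I : Finset V, G.IsIndepSet (I : Set V) → (I.card : ℤ) < q) :
    (totalComplex G).homologyFil q n = ⊥ := by
  refine eq_bot_iff.mpr fun y hy => ?_
  obtain ⟨x, hx, rfl⟩ := FilteredComplex.mem_homologyFil.mp hy
  have : x = 0 := by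
    refine Subtype.ext (Finsupp.ext fun m => ?_)
    by_contra h
    have h1 := mem_totalComplex_fil.mp hx m h
    have h2 := hq _ (isIndepSet_labelled_two (mem_totalComplex_chains.mp x.2.1 m h).1)
    unfold numTwo at h1
    omega
  rw [this, map_zero]
  exact zero_mem _

/-- The filtration of `H_0` jumps from everything to zero exactly at the independence number `α`,
and homology in the other degrees is zero. -/
theorem subsingleton_homologyGr {α : ℕ} {I : Finset V} (hI : G.IsIndepSet (I : Set V))
    (hIα : I.card = α) (hα : ∀ J : Finset V, G.IsIndepSet (J : Set V) → J.card ≤ α) {q n : ℤ}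
    (h : n ≠ 0 ∨ q ≠ α) : Subsingleton ((totalComplex G).homologyGr q n) := by
  refine subsingleton_subquotient ?_
  by_cases hn : n = 0
  · subst hn
    rcases lt_or_gt_of_ne (h.resolve_left fun h => h rfl) with hq | hq
    · rw [homologyFil_zero_eq_top hI (q := q + 1) (by omega)]
      exact le_top
    · rw [homologyFil_eq_bot (q := q) fun J hJ => by have := hα J hJ; omega]
      exact bot_le
  · have := subsingleton_homology (G := G) hn
    intro y _
    rw [Subsingleton.elim y 0]
    exact zero_mem _

/-- The limit page has a single nonzero entry, at the independence number of the graph. -/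
theorem exists_limit_page {E : SpectralSequence (ModuleCat.{u} ℤ) pageShape 0}
    {R : (totalComplex G).SpectralSequenceData E} (hR : R.Converges) :
    ∃ p₀ q₀ r₁ : ℤ, ∀ (r : ℤ) (hr : 0 ≤ r), r₁ ≤ r →
      Nonempty ((E.page r hr).X (p₀, q₀) ≃+ ℤ) ∧
      ∀ p q : ℤ, (p, q) ≠ (p₀, q₀) → Subsingleton ((E.page r hr).X (p, q)) := by
  classical
  obtain ⟨I, hI, hmax⟩ := Finset.exists_max_image
    (Finset.univ.filter fun J : Finset V => G.IsIndepSet (J : Set V)) Finset.card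
    ⟨∅, by simp [SimpleGraph.IsIndepSet]⟩
  simp only [Finset.mem_filter, Finset.mem_univ, true_and] at hI hmax
  obtain ⟨-, r₁, h⟩ := hR
  refine ⟨I.card, I.card, r₁, fun r hr hr₁ => ⟨?_, fun p q hpq => ?_⟩⟩
  · obtain ⟨e, -⟩ := (h r hr hr₁).2 I.card I.card
    obtain ⟨e₀, -⟩ := exists_homology_zero_equiv (G := G)
    -- The total degree of the entry is a difference equal to 0 only propositionally, so the degree
    -- is generalized first.
    have key : ∀ n : ℤ, n = 0 → Nonempty ((totalComplex G).homologyGr I.card n ≃+ ℤ) := by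
      rintro _ rfl
      exact exists_subquotient_top_bot_equiv e₀ (homologyFil_zero_eq_top hI le_rfl)
        (homologyFil_eq_bot fun J hJ => by have := hmax J hJ; omega)
    exact ⟨e.toAddEquiv.trans (key _ (sub_self _)).some⟩
  · obtain ⟨e, -⟩ := (h r hr hr₁).2 p q
    have : Subsingleton ((totalComplex G).homologyGr q (p - q)) := by
      refine subsingleton_homologyGr hI rfl hmax ?_
      by_contra hne
      push Not at hne
      exact hpq (Prod.ext (by simp only; omega) hne.2)
    exact e.toEquiv.subsingleton

/-- The case of the single index `U = ∅`. Using `G` itself with the identity embedding, in place of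
the induced graph on the complement of `N[∅]`, avoids comparing the two graphs. -/
theorem exists_first_row_equiv {E : SpectralSequence (ModuleCat.{u} ℤ) pageShape 0}
    (R : (totalComplex G).SpectralSequenceData E) (p : ℤ) :
    Nonempty ((E.page 1 zero_le_one).X (p, 0) ≃+
      reducedHomology (indComplex G).toPreAbstractSimplicialComplex (p - 1)) := by
  obtain ⟨e, -⟩ := exists_row_equiv R p 0
  obtain ⟨e'⟩ := exists_row_homology_equiv (G := G) (q := 0) (k := p - 1) (p := p)
    (fun _ : Unit => (∅ : Finset V)) (fun _ => OrderIso.refl V |>.toOrderEmbedding) (fun _ => G)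
    (fun _ _ _ => rfl) (fun _ => ⟨by simp [SimpleGraph.IsIndepSet], rfl⟩)
    (fun I _ hI => ⟨(), (Finset.card_eq_zero.mp (by exact_mod_cast hI)).symm⟩)
    (fun _ => by simp [closedNbhd]) (fun _ _ _ => Iff.rfl) (by ring)
  exact ⟨e.toAddEquiv.trans (e'.trans (AddEquiv.piUnique _))⟩

theorem exists_first_page_equiv_directSum {E : SpectralSequence (ModuleCat.{u} ℤ) pageShape 0}
    (R : (totalComplex G).SpectralSequenceData E) (p q : ℤ) :
    Nonempty ((E.page 1 zero_le_one).X (p, q) ≃+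
      ⨁ U : {U : Finset V // G.IsIndepSet (U : Set V) ∧ (U.card : ℤ) = q},
        reducedHomology
          (indComplex (deleteNbhd G (U.1 : Set V))).toPreAbstractSimplicialComplex
          (p - q - 1)) := by
  classical
  obtain ⟨e, -⟩ := exists_row_equiv R p q
  obtain ⟨e'⟩ := exists_row_homology_equiv (G := G) (q := q) (k := p - q - 1) (p := p)
    (fun U : {U : Finset V // G.IsIndepSet (U : Set V) ∧ (U.card : ℤ) = q} => U.1)
    (fun U => OrderEmbedding.subtype (· ∈ (closedNbhd G (U.1 : Set V))ᶜ))
    (fun U => deleteNbhd G (U.1 : Set V)) Subtype.val_injective (fun U => U.2)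
    (fun I h1 h2 => ⟨⟨I, h1, h2⟩, rfl⟩) (fun U => Subtype.range_coe) (fun _ _ _ => Iff.rfl)
    (by ring)
  exact ⟨e.toAddEquiv.trans (e'.trans (DirectSum.addEquivProd _).symm)⟩

end Limit

end IndepSS

end

open CategoryTheory DirectSum IndepSS in
theorem theorem1 {V : Type u} [Fintype V] [LinearOrder V] (G : SimpleGraph V) :
    -- a spectral sequence that is the one of `(T(G), D)`, filtered by the number of 2-markings
    ∃ (E : SpectralSequence (ModuleCat.{u} ℤ) pageShape 0)
      (R : (totalComplex G).SpectralSequenceData E),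
    -- its first page is the homology of the rows, and `d^1 [x] = [δ x]`
    (∃ ψ : ∀ p q : ℤ, (E.page 1 zero_le_one).X (p, q) ≃ₗ[ℤ] (rowComplex G q).homology p,
      (∀ (p q : ℤ) (x : (rowComplex G q).cyc p),
        ∃ h : (x : (V → Fin 3) →₀ ℤ) ∈ (totalComplex G).approxCycles 1 p q,
          ψ p q (R.proj 1 zero_le_one p q ⟨x, h⟩) = (rowComplex G q).cls p x) ∧
      (∀ (p q : ℤ) (x : (rowComplex G q).cyc p),
        ∃ h : deltaMap (x : (V → Fin 3) →₀ ℤ) ∈ (rowComplex G (q + 1)).cyc p,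
          ψ p (q + 1) (((E.page 1 zero_le_one).d (p, q) (p, q + 1)).hom
            ((ψ p q).symm ((rowComplex G q).cls p x))) =
            (rowComplex G (q + 1)).cls p ⟨deltaMap (x : (V → Fin 3) →₀ ℤ), h⟩)) ∧
    -- the row `q = 0` is the reduced homology of `Ind(G)`
    (∀ p : ℤ, Nonempty ((E.page 1 zero_le_one).X (p, 0) ≃+
      reducedHomology (indComplex G).toPreAbstractSimplicialComplex (p - 1))) ∧
    -- the row `q` is a direct sum over the independent sets `U` with `q` elements
    (∀ p q : ℤ, Nonempty ((E.page 1 zero_le_one).X (p, q) ≃+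
      ⨁ U : {U : Finset V // G.IsIndepSet (U : Set V) ∧ (U.card : ℤ) = q},
        reducedHomology
          (indComplex (deleteNbhd G (U.1 : Set V))).toPreAbstractSimplicialComplex
          (p - q - 1))) ∧
    -- the spectral sequence converges to the homology of `(T(G), D)`
    R.Converges ∧
    -- the homology of `(T(G), D)`
    Nonempty ((totalComplex G).homology 0 ≃+ ℤ) ∧
    (∀ n : ℤ, n ≠ 0 → Subsingleton ((totalComplex G).homology n)) ∧
    -- the limit page has one entry `ℤ` and is zero elsewhere
    (∃ p₀ q₀ r₁ : ℤ, ∀ (r : ℤ) (hr : 0 ≤ r), r₁ ≤ r →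
      Nonempty ((E.page r hr).X (p₀, q₀) ≃+ ℤ) ∧
      ∀ p q : ℤ, (p, q) ≠ (p₀, q₀) → Subsingleton ((E.page r hr).X (p, q))) := by
  have hR := (totalComplex G).spectralSequenceData.converges_of_bounded
    (fun _ => totalComplex_fil_eq_top) (fun _ => totalComplex_fil_eq_bot)
  obtain ⟨e, -⟩ := exists_homology_zero_equiv (G := G)
  exact ⟨(totalComplex G).spectralSequence, (totalComplex G).spectralSequenceData,
    exists_first_page_equiv (totalComplex G).spectralSequenceData,
    exists_first_row_equiv (totalComplex G).spectralSequenceData,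
    exists_first_page_equiv_directSum (totalComplex G).spectralSequenceData, hR,
    ⟨e.toAddEquiv⟩, fun _ => subsingleton_homology, exists_limit_page hR⟩
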